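/- **Setting.** Let $M$ be a compact, orientable, irreducible 3-manifold with incompressible boundary, let $T_1\neq T_2$ be two torus components of $\partial M$, and fix an orientation of $M$ and a (generalized) triangulation of $M$ that restricts to one-vertex triangulations of $T_1$ and $T_2$. Fix bases of $H_1(T_1)$ and $H_1(T_2)$ such that the orientation of the first agrees, and that of the second disagrees, with the induced boundary orientation. Slopes (isotopy classes of essential simple closed curves) on $T_i$ are thereby identified with $\widehat{\mathbb Q}=\mathbb Q\cup\{1/0\}$, on which $SL_2(\mathbb Q)$ acts by linear fractional transformations. *Normal surfaces.* A normal arc in a triangle is a properly embedded arc joining interior points of distinct edges; a normal loop on the boundary of a tetrahedron is a simple closed curve made of normal arcs. It has $3$ or $4m$ arcs, and its complexity is $0$, respectively $m-1$. A properly embedded compact surface $S\subset M$ is normal with respect to the 2-skeleton if it meets the boundary of every tetrahedron in a collection of normal loops. Two such surfaces are compatible if, on the boundary of each tetrahedron, their loops can be made disjoint by isotopies that preserve every simplex. A compatibility class is a maximal set of pairwise compatible such surfaces. In a one-vertex triangulation of a torus, a normal curve has type $i$ if the number $x_i$ of its arcs that cut off the $i$-th corner of a fixed one of the two triangles is minimal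 among $x_1,x_2,x_3$. A typed compatibility class is the non-empty set of all surfaces in a compatibility class that have a given type on $T_1$ and a given type on $T_2$; its complexity is the maximum of the complexities of the normal loops of its members. *$c$-distance.* For each typed compatibility class $\mathcal C$ choose an element $\Phi_{\mathcal C}\in SL_2(\mathbb Q)$ that maps the slope of $S\cap T_2$ to the slope of $S\cap T_1$ for every $S\in\mathcal C$ that has a slope on both tori and satisfies $S\cap\partial M\subset T_1\cup T_2$. Let $\phi\colon T_1\to T_2$ be a homeomorphism. The distance of $\phi\Phi_{\mathcal C}$ is the minimum, over all slopes $\gamma$ on $T_2$, of the distance between $\gamma$ and $\phi(\Phi_{\mathcal C}(\gamma))$ in the Farey graph of $T_2$ (whose vertices are the slopes, two being adjacent if they have simple closed curve representatives that meet in exactly one point). The $c$-distance of $\phi$ is the minimum of the distances of $\phi\Phi_{\mathcal C}$ over all typed compatibility classes $\mathcal C$ of complexity at most $c$. **Theorem 1.3.** Let $\psi\colon T_1\to T_2$ and $\sigma\colon T_2\to T_2$ be homeomorphisms that act on first homology, with respect to the fixed bases, as elements of $SL_2(\mathbb Z)$, and let $\sigma$ be Anosov, that is, let its action on $H_1(T_2)$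 have trace of absolute value greater than $2$. Then, for every choice of the elements $\Phi_{\mathcal C}$ and every integer $c\ge 0$, there is a positive integer $N$ such that for all $n\ge N$ the map $\sigma^n\psi\colon T_1\to T_2$ has $c$-distance at least one. -/

import Mathlib

open scoped Manifold

noncomputable section

namespace GluingDistance

/-! ### 3-manifolds -/

section Manifolds

variable (M : Type*) [TopologicalSpace M] [ChartedSpace (EuclideanHalfSpace 3) M]

/-- The boundary of a 3-manifold with boundary. -/
abbrev bdry : Set M := (𝓡∂ 3).boundary M

/-- `M` is irreducible: every (two-sided, that is bicollared) embedded 2-sphere in the interior of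
`M` bounds an embedded closed 3-ball. -/
def IsIrreducible : Prop :=
  ∀ f : C(Metric.sphere (0 : EuclideanSpace ℝ (Fin 3)) 1 × Set.Icc (-1 : ℝ) 1, M),
    Function.Injective f → (∀ p, f p ∉ bdry M) →
    ∃ g : C(Metric.closedBall (0 : EuclideanSpace ℝ (Fin 3)) 1, M), Function.Injective g ∧
      g '' {x | ‖x.1‖ = 1} = f '' {p | (p.2 : ℝ) = 0}

/-- `M` has incompressible boundary: the boundary of every properly embedded disk in `M` bounds a
disk embedded in the boundary of `M`. -/
def HasIncompressibleBoundary : Prop :=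
  ∀ f : C(Metric.closedBall (0 : EuclideanSpace ℝ (Fin 2)) 1, M),
    Function.Injective f → (∀ x, f x ∈ bdry M ↔ ‖x.1‖ = 1) →
    ∃ g : C(Metric.closedBall (0 : EuclideanSpace ℝ (Fin 2)) 1, M), Function.Injective g ∧
      (∀ x, g x ∈ bdry M) ∧ g '' {x | ‖x.1‖ = 1} = f '' {x | ‖x.1‖ = 1}

variable {M}

/-- `T` is a connected component of the boundary of `M`. -/
def IsBoundaryComponent (T : Set M) : Prop :=
  ∃ x ∈ bdry M, T = connectedComponentIn (bdry M) x

/-- `S` is a compact surface (2-manifold with boundary) properly embedded in `M`, that is, its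
boundary is its intersection with the boundary of `M`. -/
def IsProperSurface (S : Set M) : Prop :=
  IsCompact S ∧ ∃ _ : ChartedSpace (EuclideanHalfSpace 2) S,
    Subtype.val '' ((𝓡∂ 2).boundary S) = S ∩ bdry M

end Manifolds

/-! ### The standard tetrahedron and normal curves on its boundary -/

/-- The standard tetrahedron; its points are given by their barycentric coordinates. -/
abbrev Tet : Type := stdSimplex ℝ (Fin 4)

/-- The closed face of the tetrahedron opposite to the vertex `a`. -/
def face (a : Fin 4) : Set Tet := {x | x a = 0}

/-- The boundary sphere of the tetrahedron. -/
def tetBoundary : Set Tet := {x | ∃ a, x a = 0}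

/-- `A` is a straight normal arc in the face `a`: a segment that joins interior points of two
distinct edges (those opposite to the vertices `b` and `b'`) of that face. -/
def IsStraightNormalArc (a : Fin 4) (A : Set Tet) : Prop :=
  ∃ b b' : Fin 4, b ≠ a ∧ b' ≠ a ∧ b ≠ b' ∧ ∃ p q : Tet,
    (∀ k, p k = 0 ↔ k = a ∨ k = b) ∧ (∀ k, q k = 0 ↔ k = a ∨ k = b') ∧
    A = {x : Tet | x.1 ∈ segment ℝ p.1 q.1}

/-- `K` is a closed curve (a finite disjoint union of loops, possibly empty) on the boundary of the
tetrahedron that meets each face in finitely many disjoint straight normal arcs. -/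
def IsStraightNormalCurve (K : Set Tet) : Prop :=
  K ⊆ tetBoundary ∧ ∀ a, ∃ 𝒜 : Set (Set Tet), 𝒜.Finite ∧ (∀ A ∈ 𝒜, IsStraightNormalArc a A) ∧
    𝒜.PairwiseDisjoint id ∧ K ∩ face a = ⋃₀ 𝒜

/-- `K` and `K'` are normally isotopic: there is an isotopy of (embeddings of) `K` that ends with
`K'` and restricts to an isotopy in each face and in each edge. -/
def NormallyIsotopic (K K' : Set Tet) : Prop :=
  ∃ H : C(unitInterval × K, Tet),
    (∀ t, Function.Injective fun x ↦ H (t, x)) ∧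
    (∀ x, H (0, x) = x) ∧ (Set.range fun x ↦ H (1, x)) = K' ∧
    ∀ t x a, H (t, x) a = 0 ↔ x.1 a = 0

/-- `K` is a finite disjoint union of normal loops on the boundary of the tetrahedron. Any finite
family of disjoint properly embedded arcs in a triangle, each of which connects interior points
of distinct edges, can be straightened by an isotopy of the triangle that preserves the edges;
normal curves are therefore the curves that are normally isotopic to a straight one. -/
def IsNormalCurve (K : Set Tet) : Prop :=
  ∃ K₀, IsStraightNormalCurve K₀ ∧ NormallyIsotopic K K₀

/-- The normal loops of a normal curve: its connected components. -/
def loops (K : Set Tet) : Set (Set Tet) := {L | ∃ x ∈ K, L = connectedComponentIn K x}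

/-- The normal arcs of a normal curve in the face `a`. -/
def arcs (K : Set Tet) (a : Fin 4) : Set (Set Tet) :=
  {A | ∃ x ∈ K ∩ face a, A = connectedComponentIn (K ∩ face a) x}

/-- The number of normal arcs of a normal loop. -/
def loopLength (L : Set Tet) : ℕ := ∑ a, (arcs L a).ncard

/-- The complexity of a normal loop: a loop of `3` arcs has complexity `0`, and a loop of `4 * n`
arcs has complexity `n - 1`; no other lengths occur. -/
def loopComplexity (L : Set Tet) : ℕ := loopLength L / 4 - 1

/-- The number of normal arcs of `K` in the face `a` that cut off the corner `b` of that face,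
that is, that meet both edges of the face at `b`. -/
def cornerCount (K : Set Tet) (a b : Fin 4) : ℕ :=
  {A ∈ arcs K a | ∀ b', b' ≠ a → b' ≠ b → ∃ y ∈ A, y b' = 0}.ncard

/-- The normal curves `K` and `K'` can be normally isotoped to be disjoint, so that they form a
normal curve together. -/
def CanBeMadeDisjoint (K K' : Set Tet) : Prop :=
  ∃ L L', NormallyIsotopic K L ∧ NormallyIsotopic K' L' ∧ Disjoint L L' ∧ IsNormalCurve (L ∪ L')

/-! ### Triangulations -/

/-- A (generalized) triangulation of `M`: finitely many tetrahedra with characteristic maps onto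
`M` that are injective on every open simplex and have disjoint interiors, such that two points have
the same image only if the closed simplices that carry them are identified by an affine map. Simplices of a tetrahedron
may be identified with each other, so that one-vertex triangulations are allowed. -/
structure Triangulation (M : Type*) [TopologicalSpace M] where
  /-- the tetrahedra -/
  ι : Type
  /-- there are finitely many of them -/
  finite : Finite ι
  /-- the characteristic maps -/
  χ : ι → C(Tet, M)
  covers : ∀ m, ∃ i x, χ i x = m
  inj : ∀ i x y, (∀ a, x a = 0 ↔ y a = 0) → χ i x = χ i y → x = y
  disj : ∀ i j x y, (∀ a, x a ≠ 0) → χ i x = χ j y → i = j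
  glue : ∀ i j x y, χ i x = χ j y → ∃ ρ : Equiv.Perm (Fin 4), (∀ a, y (ρ a) = x a) ∧
    ∀ z w : Tet, (∀ a, x a = 0 → z a = 0) → (∀ a, w (ρ a) = z a) → χ i z = χ j w

namespace Triangulation

section

variable {M : Type*} [TopologicalSpace M] (𝒯 : Triangulation M)

/-- `p` is a vertex of the triangulation. -/
def IsVertex (p : M) : Prop := ∃ i x a, x a = 1 ∧ 𝒯.χ i x = p

/-- The triangulation restricts to a one-vertex triangulation on `T`. -/
def OneVertexOn (T : Set M) : Prop := ∃! p, p ∈ T ∧ 𝒯.IsVertex p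

/-- The triangles (given by a tetrahedron and one of its faces) that are contained in `T`. -/
def FaceIn (T : Set M) : Type := {f : 𝒯.ι × Fin 4 // ∀ x ∈ face f.2, 𝒯.χ f.1 x ∈ T}

/-- An orientation of the triangulated 3-manifold: each tetrahedron carries a sign (that compares
its orientation with the one given by the order of its vertices), so that the
orientations of adjacent tetrahedra induce opposite orientations on their common face. -/
structure Orientation where
  /-- the sign of a tetrahedron -/
  sign : 𝒯.ι → ℤˣ
  coherent : ∀ (i j : 𝒯.ι) (a b : Fin 4) (ρ : Equiv.Perm (Fin 4)), (i, a) ≠ (j, b) → ρ a = b →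
    (∀ z w : Tet, z ∈ face a → (∀ k, w (ρ k) = z k) → 𝒯.χ i z = 𝒯.χ j w) →
    sign j = -(Equiv.Perm.sign ρ * sign i)

/-- The part of `S` on the boundary of the tetrahedron `i`. -/
def trace (S : Set M) (i : 𝒯.ι) : Set Tet := {x ∈ tetBoundary | 𝒯.χ i x ∈ S}

/-- The complexity of a surface that is normal with respect to the 2-skeleton: the maximum of the
complexities of the normal loops in which it meets the boundaries of the tetrahedra. -/
def surfaceComplexity (S : Set M) : ℕ∞ :=
  ⨆ i, ⨆ L ∈ loops (𝒯.trace S i), (loopComplexity L : ℕ∞)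

/-- The complexity of a class of surfaces: the maximum of the complexities of its members
(infinite if they are unbounded). -/
def classComplexity (D : Set (Set M)) : ℕ∞ := ⨆ S ∈ D, 𝒯.surfaceComplexity S

/-- Two surfaces that are normal with respect to the 2-skeleton are compatible if on the boundary of
each tetrahedron their curves can be normally isotoped to be disjoint. -/
def Compatible (F G : Set M) : Prop := ∀ i, CanBeMadeDisjoint (𝒯.trace F i) (𝒯.trace G i)

variable {𝒯} in
/-- On the torus that contains the triangle `t`, the curve `S ∩ T` has type `b`, where the types are
labelled by the corners of `t`: the coordinate at `b` is minimal. In a one-vertex triangulation of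
a torus the coordinates in the other triangle are the same. -/
def HasType {T : Set M} (t : 𝒯.FaceIn T) (S : Set M) (b : Fin 4) : Prop :=
  b ≠ t.1.2 ∧ ∀ b', b' ≠ t.1.2 →
    cornerCount (𝒯.trace S t.1.1) t.1.2 b ≤ cornerCount (𝒯.trace S t.1.1) t.1.2 b'

end

section

variable {M : Type*} [TopologicalSpace M] [ChartedSpace (EuclideanHalfSpace 3) M]
  (𝒯 : Triangulation M)

/-- `S` is a properly embedded surface that is normal with respect to the 2-skeleton: it meets the
boundary of every tetrahedron in a collection of normal loops. -/
def IsNormalSurface (S : Set M) : Prop :=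
  IsProperSurface S ∧ ∀ i, IsNormalCurve (𝒯.trace S i)

/-- A compatibility class: a maximal set of pairwise compatible surfaces that are normal with respect
to the 2-skeleton. -/
def IsCompatibilityClass (C : Set (Set M)) : Prop :=
  Maximal (fun C ↦ (∀ S ∈ C, 𝒯.IsNormalSurface S) ∧ ∀ F ∈ C, ∀ G ∈ C, 𝒯.Compatible F G) C

variable {𝒯} in
/-- A typed compatibility class: the (non-empty) set of those surfaces in a compatibility class that
have a given pair of types on the tori that contain the triangles `t₁` and `t₂`. -/
def IsTypedClass {T₁ T₂ : Set M} (t₁ : 𝒯.FaceIn T₁) (t₂ : 𝒯.FaceIn T₂) (D : Set (Set M)) : Prop :=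
  D.Nonempty ∧ ∃ C, 𝒯.IsCompatibilityClass C ∧ ∃ b₁ b₂, b₁ ≠ t₁.1.2 ∧ b₂ ≠ t₂.1.2 ∧
    D = {S ∈ C | HasType t₁ S b₁ ∧ HasType t₂ S b₂}

end

end Triangulation

/-! ### Tori, homology bases, slopes -/

/-- The universal covering of the standard torus `ℝ² / ℤ²`. -/
def torusProj (x : Fin 2 → ℝ) : UnitAddTorus (Fin 2) := fun k ↦ (x k : UnitAddCircle)

/-- Twice the signed area of the image of the face `a`, with the vertex order inherited from the
tetrahedron, under a map to the plane that is linear in the barycentric coordinates. -/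
def faceDet (L : (Fin 4 → ℝ) →ₗ[ℝ] (Fin 2 → ℝ)) (a : Fin 4) : ℝ :=
  let e : Fin 3 → Fin 2 → ℝ := fun k ↦ L (Pi.single (a.succAbove k) 1)
  Matrix.det !![(e 1 - e 0) 0, (e 2 - e 0) 0; (e 1 - e 0) 1, (e 2 - e 0) 1]

/-- A homology basis of the triangulated boundary torus `T`, given as an identification of `T` with
the standard torus `ℝ² / ℤ²` that is affine on the triangles of `T`. The orientation of the
basis agrees with the boundary orientation of `T` (the face opposite to the vertex number `a` of a
positively oriented tetrahedron is oriented by `(-1) ^ a` times its vertex order) if `s = 1`, and it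
disagrees with it if `s = -1`. -/
structure HomologyBasis {M : Type*} [TopologicalSpace M] (𝒯 : Triangulation M) (o : 𝒯.Orientation)
    (T : Set M) (s : ℤˣ) where
  /-- the identification with the standard torus -/
  homeo : T ≃ₜ UnitAddTorus (Fin 2)
  affine : ∀ f : 𝒯.FaceIn T, ∃ L : (Fin 4 → ℝ) →ₗ[ℝ] (Fin 2 → ℝ),
    (∀ x (hx : x ∈ face f.1.2), homeo ⟨𝒯.χ f.1.1 x, f.2 x hx⟩ = torusProj (L x.1)) ∧
    0 < (((s * o.sign f.1.1 * (-1) ^ (f.1.2 : ℕ) : ℤˣ) : ℤ) : ℝ) * faceDet L f.1.2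

/-- Slopes, with respect to a homology basis: `ℚ ∪ {1/0}`. -/
abbrev Slope : Type := OnePoint ℚ

/-- The slope `v 0 / v 1` of the homology class `v`. -/
def slopeOf (v : Fin 2 → ℤ) : Slope :=
  if v 1 = 0 then OnePoint.infty else (((v 0 : ℚ) / (v 1 : ℚ) : ℚ) : OnePoint ℚ)

/-- The action of `SL₂(ℚ)` on slopes by linear fractional transformations. -/
def act (Φ : Matrix.SpecialLinearGroup (Fin 2) ℚ) (p : Slope) : Slope :=
  (Φ : Matrix.GeneralLinearGroup (Fin 2) ℚ) • p

section Tori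

variable {X Y : Type*} [TopologicalSpace X] [TopologicalSpace Y]
  (τ : X ≃ₜ UnitAddTorus (Fin 2)) (τ' : Y ≃ₜ UnitAddTorus (Fin 2))

/-- The loop `c` on the torus `X` has homology class `v`, in the basis given by `τ`: a lift of `c` to
the universal covering is translated by `v` when `c` is run through once. -/
def HasClass (c : C(UnitAddCircle, X)) (v : Fin 2 → ℤ) : Prop :=
  ∃ γ : ℝ → Fin 2 → ℝ, Continuous γ ∧ (∀ t : ℝ, τ (c (t : UnitAddCircle)) = torusProj (γ t)) ∧
    ∀ t, γ (t + 1) = γ t + fun k ↦ (v k : ℝ)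

/-- `c` is an essential simple closed curve of slope `p` on the torus `X`. -/
def HasSlope (c : C(UnitAddCircle, X)) (p : Slope) : Prop :=
  Function.Injective c ∧ ∃ v, v ≠ 0 ∧ HasClass τ c v ∧ slopeOf v = p

/-- The Farey graph of the torus `X`: two distinct slopes are adjacent if they are represented by
simple closed curves that meet in exactly one point. -/
def fareyGraph : SimpleGraph Slope where
  Adj p q := p ≠ q ∧ ∃ c d : C(UnitAddCircle, X), HasSlope τ c p ∧ HasSlope τ d q ∧
    ∃! x, x ∈ Set.range c ∧ x ∈ Set.range d
  symm := ⟨by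
    rintro p q ⟨h, c, d, hc, hd, hx⟩
    exact ⟨h.symm, d, c, hd, hc, by simpa only [and_comm] using hx⟩⟩
  loopless := ⟨fun _ h ↦ h.1 rfl⟩

/-- The homeomorphism `φ` induces the linear map with matrix `A` on first homology. -/
def InducesOnHomology (φ : X ≃ₜ Y) (A : Matrix (Fin 2) (Fin 2) ℤ) : Prop :=
  ∀ c v, HasClass τ c v → HasClass τ' ((φ : C(X, Y)).comp c) (A.mulVec v)

/-- `φ` maps (simple closed curves of) slope `p` to slope `q`. -/
def MapsSlope (φ : X ≃ₜ Y) (p q : Slope) : Prop :=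
  ∃ c, HasSlope τ c p ∧ HasSlope τ' ((φ : C(X, Y)).comp c) q

/-- `φ` is compatible with the orientations given by the two homology bases, that is, it acts on
homology as an element of `SL₂(ℤ)`. -/
def PreservesOrientation (φ : X ≃ₜ Y) : Prop :=
  ∃ A, InducesOnHomology τ τ' φ A ∧ A.det = 1

/-- `σ` is an (orientation-preserving) Anosov map of a torus: it acts on homology as a hyperbolic
element of `SL₂(ℤ)`. -/
def IsAnosov (σ : X ≃ₜ X) : Prop :=
  ∃ A, InducesOnHomology τ τ σ A ∧ A.det = 1 ∧ 2 < |A.trace|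

/-- The distance of `φ Φ`, where `φ` is a homeomorphism of tori from `X` to `Y` and `Φ` maps slopes on
`Y` to slopes on `X`: the minimum, over the slopes `p` on `Y`, of the distance between `p` and
`φ (Φ p)` in the Farey graph of `Y`. -/
def mapDistance (φ : X ≃ₜ Y) (Φ : Matrix.SpecialLinearGroup (Fin 2) ℚ) : ℕ∞ :=
  ⨅ p : Slope, ⨅ q : Slope, ⨅ _ : MapsSlope τ τ' φ (act Φ p) q, (fareyGraph τ').edist p q

end Tori

section Distance

variable {M : Type*} [TopologicalSpace M] [ChartedSpace (EuclideanHalfSpace 3) M]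
  {T₁ T₂ : Set M} (τ₁ : T₁ ≃ₜ UnitAddTorus (Fin 2)) (τ₂ : T₂ ≃ₜ UnitAddTorus (Fin 2))

/-- The surface `S` has slope `p` on the torus `T`: some essential component of `S ∩ T` has slope
`p`. -/
def SurfaceHasSlope {T : Set M} (τ : T ≃ₜ UnitAddTorus (Fin 2)) (S : Set M) (p : Slope) : Prop :=
  ∃ c : C(UnitAddCircle, T), HasSlope τ c p ∧ ∀ t, (c t : M) ∈ S

/-- `Φ` maps the slope on `T₂` to the slope on `T₁`, for every surface in `D` that meets the boundary
of `M` in `T₁ ∪ T₂` only and has slopes on both tori. -/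
def TransfersSlopes (D : Set (Set M)) (Φ : Matrix.SpecialLinearGroup (Fin 2) ℚ) : Prop :=
  ∀ S ∈ D, (S ∩ T₁).Nonempty → (S ∩ T₂).Nonempty → S ∩ bdry M ⊆ T₁ ∪ T₂ →
    ∀ p q, SurfaceHasSlope τ₁ S p → SurfaceHasSlope τ₂ S q → act Φ q = p

variable {𝒯 : Triangulation M} (t₁ : 𝒯.FaceIn T₁) (t₂ : 𝒯.FaceIn T₂)

/-- `Φ` is a choice of an element `Φ D` of `SL₂(ℚ)` that transfers slopes, for each typed
compatibility class `D`. (If there were no such element for some `D`, then `Φ D` would be arbitrary: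
that such elements exist is not presupposed.) -/
def IsChoiceOfTransfers (Φ : Set (Set M) → Matrix.SpecialLinearGroup (Fin 2) ℚ) : Prop :=
  ∀ D, Triangulation.IsTypedClass t₁ t₂ D →
    (∃ Ψ, TransfersSlopes τ₁ τ₂ D Ψ) → TransfersSlopes τ₁ τ₂ D (Φ D)

/-- The `c`-distance of the gluing map `φ`: the minimum of the distances of `φ Φ_D`, over all typed
compatibility classes `D` of complexity at most `c`. -/
def cDistance (Φ : Set (Set M) → Matrix.SpecialLinearGroup (Fin 2) ℚ) (c : ℕ) (φ : T₁ ≃ₜ T₂) : ℕ∞ :=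
  ⨅ D : Set (Set M), ⨅ _ : Triangulation.IsTypedClass t₁ t₂ D, ⨅ _ : 𝒯.classComplexity D ≤ c,
    mapDistance τ₁ τ₂ φ (Φ D)

end Distance

end GluingDistance

end

open GluingDistance

open scoped Manifold

noncomputable section

namespace GluingDistance

/-! ### Hyperbolic matrices and rational eigenvectors. -/

section Arithmetic

/-! The distance of `φ Φ` can vanish only if `φ Φ` fixes a slope, and then `B Φ` has a rational
eigenvector, where `B` is the action of `φ` on homology. For one fixed `Φ` this is impossible for `σ
^ n ψ` with `n` large. Let `A` and `P` be the actions of `σ` and `ψ`, and let `d` be a common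
denominator of `Φ`. The integers `s n = d * tr (A ^ n P Φ)` satisfy `s (n + 2) = tr A * s (n + 1) -
s n` by Cayley–Hamilton. Since `|tr A| ≥ 3`, they are eventually zero or unbounded in the strong
sense that `|s n|` finally exceeds every bound (`recurrence_eventually_zero_or_large`). A rational
eigenvalue `l` solves `d l² - s l + d = 0`, which forces `s ≠ 0` and `|s| ≤ 2 d²`
(`trace_bound_of_rational_root`).

A single `N` for all classes exists because only finitely many typed compatibility classes have
complexity at most `c` (`Triangulation.finite_typedClasses`). Loops of bounded complexity have
bounded edge weights, so only finitely many sets of weight vectors can occur on each tetrahedron.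
These data determine a class of given types: if `F` and `S` have the same loop weights on each
tetrahedron, then `S` is compatible with everything that `F` is compatible with, so by maximality
`S` lies in every class that contains `F`.

The last point rests on `CanBeMadeDisjoint.of_loops`. Make the curve of `F` disjoint from another
curve, and replace each of its loops with a suitable number of parallel copies, possibly none. The
result has the edge weights of `S`, and edge weights determine a normal curve up to normal isotopy
(`IsPattern.normallyIsotopic`): in each face they determine how many arcs cut off each corner, and
since these arcs are nested, they join points of equal rank on the two edges. Patterns of straight
arcs, given by their endpoints, make all of this combinatorial. -/

theorem recurrence_eventually_zero_or_large (s : ℕ → ℤ) (T B : ℤ) (hT : 2 < |T|)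
    (h : ∀ n, s (n + 2) = T * s (n + 1) - s n) : ∃ N, ∀ n, N ≤ n → s n = 0 ∨ B < |s n| := by
  -- A strong convexity of `|s|`, from `|T| ≥ 3`: once `|s|` has increased strictly, it does so
  -- forever.
  have key : ∀ n, 3 * |s (n + 1)| ≤ |s (n + 2)| + |s n| := by
    intro n
    have h1 : T * s (n + 1) = s (n + 2) + s n := by rw [h n]; ring
    calc 3 * |s (n + 1)| ≤ |T| * |s (n + 1)| :=
          mul_le_mul_of_nonneg_right (by omega) (abs_nonneg _)
      _ = |s (n + 2) + s n| := by rw [← abs_mul, h1]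
      _ ≤ _ := abs_add_le _ _
  by_cases hinc : ∃ m, |s m| < |s (m + 1)|
  · obtain ⟨m, hm⟩ := hinc
    have hstep : ∀ k, |s (m + k)| < |s (m + k + 1)| := by
      intro k
      induction k with
      | zero => simpa using hm
      | succ k ih =>
        have := key (m + k)
        have h0 := abs_nonneg (s (m + k))
        have e : m + (k + 1) + 1 = m + k + 2 := by ring
        rw [e, ← add_assoc]
        omega
    have hgrow : ∀ k : ℕ, (k : ℤ) ≤ |s (m + k)| := by
      intro k
      induction k with
      | zero => simp
      | succ k ih =>
        have := hstep k
        rw [← add_assoc]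
        push_cast
        omega
    refine ⟨m + (B.toNat + 1), fun n hn ↦ Or.inr ?_⟩
    obtain ⟨k, rfl⟩ := Nat.exists_eq_add_of_le (show m ≤ n by omega)
    have := hgrow k
    omega
  · push Not at hinc
    -- A non-increasing sequence of natural numbers has three equal consecutive terms. By `key`
    -- their common value `x` satisfies `3 x ≤ 2 x`, so it is zero, and so are all later terms.
    have hz : ∀ k n : ℕ, |s n| ≤ k → ∃ N, n ≤ N ∧ |s N| = |s (N + 1)| ∧ |s N| = |s (N + 2)| := by
      intro k
      induction k using Nat.strong_induction_on with
      | _ k ih =>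
        intro n hn
        by_cases h1 : |s (n + 2)| = |s n|
        · have h2 : |s (n + 1)| ≤ |s n| := hinc n
          have h3 : |s (n + 2)| ≤ |s (n + 1)| := hinc (n + 1)
          exact ⟨n, le_rfl, by omega, by omega⟩
        · have h2 := hinc n
          have h3 : |s (n + 2)| ≤ |s (n + 1)| := hinc (n + 1)
          have h4 := abs_nonneg (s (n + 2))
          obtain ⟨N, hN, h5⟩ := ih (|s (n + 2)|).toNat (by omega) (n + 2) (by omega)
          exact ⟨N, by omega, h5⟩
    obtain ⟨N, -, h1, h2⟩ := hz (|s 0|).toNat 0 (by simp)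
    have h3 := key N
    have h4 := abs_nonneg (s N)
    have hN0 : |s N| = 0 := by omega
    refine ⟨N, fun n hn ↦ Or.inl ?_⟩
    induction n, hn using Nat.le_induction with
    | base => exact abs_eq_zero.mp hN0
    | succ n _ ih =>
      have := hinc n
      rw [ih, abs_zero] at this
      exact abs_eq_zero.mp (le_antisymm this (abs_nonneg _))

/-- The number `k = d * l` is a root of the monic polynomial `X² - s X + d²`, hence an integer with
`k (s - k) = d²`. Both factors divide `d²`, which bounds their sum `s`; if `s` were zero, the
product would be `-k² ≤ 0`. -/
theorem trace_bound_of_rational_root (d s : ℤ) (hd : 0 < d) (l : ℚ)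
    (h : (d : ℚ) * l ^ 2 - s * l + d = 0) : s ≠ 0 ∧ |s| ≤ 2 * d ^ 2 := by
  have hd0 : (d : ℚ) ≠ 0 := by exact_mod_cast hd.ne'
  have hint : IsIntegral ℤ ((d : ℚ) * l) := by
    refine ⟨Polynomial.X ^ 2 - Polynomial.C s * Polynomial.X + Polynomial.C (d ^ 2), ?_, ?_⟩
    · monicity!
    · simp only [Polynomial.eval₂_add, Polynomial.eval₂_sub, Polynomial.eval₂_mul,
        Polynomial.eval₂_pow, Polynomial.eval₂_X, Polynomial.eval₂_C]
      simp only [algebraMap_int_eq, eq_intCast]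
      push_cast
      linear_combination (d : ℚ) * h
  obtain ⟨k, hk⟩ := IsIntegrallyClosed.isIntegral_iff.mp hint
  have hk' : (k : ℚ) = d * l := by simpa using hk
  have e : k * (s - k) = d ^ 2 := by
    have : (k : ℚ) * (s - k) = d ^ 2 := by
      rw [hk']
      linear_combination -(d : ℚ) * h
    exact_mod_cast this
  have hd2 : 0 < d ^ 2 := by positivity
  have hk0 : k ≠ 0 := by rintro rfl; simp at e; omega
  have hs0 : s - k ≠ 0 := by intro h0; rw [h0] at e; simp at e; omega
  have h1 := Int.le_of_dvd hd2 ((abs_dvd k _).mpr ⟨_, e.symm⟩)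
  have h2 := Int.le_of_dvd hd2 ((abs_dvd (s - k) _).mpr ⟨k, by rw [← e]; ring⟩)
  refine ⟨?_, ?_⟩
  · rintro rfl
    nlinarith [sq_nonneg k]
  · calc |s| = |k + (s - k)| := by congr 1; ring
      _ ≤ |k| + |s - k| := abs_add_le _ _
      _ ≤ _ := by omega

theorem charpoly_of_eigenvector (M : Matrix (Fin 2) (Fin 2) ℚ) (x : Fin 2 → ℚ) (hx : x ≠ 0) (l : ℚ)
    (h : M.mulVec x = l • x) : l ^ 2 - M.trace * l + M.det = 0 := by
  have h0 := congrFun h 0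
  have h1 := congrFun h 1
  simp only [Matrix.mulVec_fin_two, Matrix.cons_val_zero, Matrix.cons_val_one, Pi.smul_apply,
    smul_eq_mul] at h0 h1
  rw [Matrix.det_fin_two, Matrix.trace_fin_two]
  have : x 0 ≠ 0 ∨ x 1 ≠ 0 := by
    by_contra! hc
    apply hx
    ext i
    fin_cases i
    · exact hc.1
    · exact hc.2
  rcases this with hx | hx
  · apply mul_right_cancel₀ hx
    linear_combination (l - M 1 1) * (-h0) - M 0 1 * h1
  · apply mul_right_cancel₀ hx
    linear_combination (l - M 0 0) * (-h1) - M 1 0 * h0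

/-- Cayley–Hamilton; taking traces against a fixed matrix turns it into the scalar recurrence. -/
theorem pow_add_two_of_det_one (A : Matrix (Fin 2) (Fin 2) ℤ) (hA : A.det = 1) (n : ℕ) :
    A ^ (n + 2) = A.trace • A ^ (n + 1) - A ^ n := by
  have h2 : A ^ 2 = A.trace • A - 1 := by
    rw [Matrix.det_fin_two] at hA
    rw [Matrix.trace_fin_two]
    ext i j
    fin_cases i <;> fin_cases j <;>
      simp [pow_two, Matrix.mul_apply, Fin.sum_univ_two, -zsmul_eq_mul]
    · linear_combination -hA
    · ring
    · ring
    · linear_combination -hA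
  rw [pow_add, h2, mul_sub, mul_one, Matrix.mul_smul, pow_succ]

theorem exists_common_denominator (Φ : Matrix (Fin 2) (Fin 2) ℚ) :
    ∃ d : ℤ, 0 < d ∧ ∃ Ψ : Matrix (Fin 2) (Fin 2) ℤ, ∀ i j, (Ψ i j : ℚ) = d * Φ i j := by
  obtain ⟨⟨d, hd⟩, h⟩ := IsLocalization.exist_integer_multiples_of_finite (nonZeroDivisors ℤ)
    (fun p : Fin 2 × Fin 2 ↦ Φ p.1 p.2)
  choose Ψ hΨ using h
  have hd0 : d ≠ 0 := nonZeroDivisors.ne_zero hd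
  -- The denominator is only known to be nonzero, so its sign is absorbed in the integral matrix.
  refine ⟨|d|, abs_pos.mpr hd0, fun i j ↦ SignType.sign d * Ψ (i, j), fun i j ↦ ?_⟩
  have := hΨ (i, j)
  simp only [eq_intCast, zsmul_eq_mul] at this
  push_cast
  rw [this]
  rcases lt_or_gt_of_ne hd0 with h | h
  · have h' : (d : ℚ) < 0 := by exact_mod_cast h
    simp [h, abs_of_neg h']
  · have h' : 0 < (d : ℚ) := by exact_mod_cast h
    simp [h, abs_of_pos h']

/-- The products `A ^ n * P * Φ`, with `A` hyperbolic, have no rational eigenvectors for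
large `n`. -/
theorem eventually_no_rational_eigenvector (A P : Matrix (Fin 2) (Fin 2) ℤ) (hA : A.det = 1)
    (hP : P.det = 1) (htr : 2 < |A.trace|) (Φ : Matrix (Fin 2) (Fin 2) ℚ) (hΦ : Φ.det = 1) :
    ∃ N : ℕ, ∀ n, N ≤ n → ∀ x : Fin 2 → ℚ, x ≠ 0 → ∀ l : ℚ,
      ((A ^ n * P).map (Int.cast : ℤ → ℚ) * Φ).mulVec x ≠ l • x := by
  obtain ⟨d, hd, Ψ, hΨ⟩ := exists_common_denominator Φ
  obtain ⟨N, hN⟩ := recurrence_eventually_zero_or_large (fun n ↦ (A ^ n * P * Ψ).trace) A.trace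
    (2 * d ^ 2) htr (by
      intro n
      simp only [pow_add_two_of_det_one A hA, sub_mul, Matrix.trace_sub, Matrix.smul_mul,
        Matrix.trace_smul, smul_eq_mul])
  refine ⟨N, fun n hn x hx l hl ↦ ?_⟩
  have hchar := charpoly_of_eigenvector _ x hx l hl
  have hdet : ((A ^ n * P).map (Int.cast : ℤ → ℚ) * Φ).det = 1 := by
    rw [Matrix.det_mul, hΦ, mul_one]
    have := Int.cast_det (R := ℚ) (A ^ n * P)
    rw [← this, Matrix.det_mul, Matrix.det_pow, hA, hP]
    simp
  have htrace : (((A ^ n * P * Ψ).trace : ℤ) : ℚ) =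
      d * ((A ^ n * P).map (Int.cast : ℤ → ℚ) * Φ).trace := by
    simp only [Matrix.trace_fin_two, Matrix.mul_apply (N := Ψ), Matrix.mul_apply (N := Φ),
      Fin.sum_univ_two, Matrix.map_apply]
    push_cast
    simp only [hΨ]
    ring
  rw [hdet] at hchar
  -- Both alternatives left by the recurrence, trace zero and trace beyond `2 * d ^ 2`, contradict
  -- this bound.
  obtain ⟨h0, h1⟩ := trace_bound_of_rational_root d (A ^ n * P * Ψ).trace hd l (by
    rw [htrace]; linear_combination (d : ℚ) * hchar)
  rcases hN n hn with h | h
  · exact h0 h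
  · exact absurd h1 (not_le.mpr h)

end Arithmetic

/-! ### Homology classes, slopes and fixed slopes. -/

section Slopes

variable {X Y Z : Type*} [TopologicalSpace X] [TopologicalSpace Y] [TopologicalSpace Z]
  {τ : X ≃ₜ UnitAddTorus (Fin 2)} {τ' : Y ≃ₜ UnitAddTorus (Fin 2)}
  {τ'' : Z ≃ₜ UnitAddTorus (Fin 2)}

/-- The difference of two lifts of the loop is continuous and integral in each coordinate, hence
constant on the line, so both lifts undergo the same translation. -/
theorem HasClass.unique {c : C(UnitAddCircle, X)} {v w : Fin 2 → ℤ} (hv : HasClass τ c v)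
    (hw : HasClass τ c w) : v = w := by
  obtain ⟨γ, hγ, hγc, hγv⟩ := hv
  obtain ⟨δ, hδ, hδc, hδw⟩ := hw
  funext k
  have hint : ∀ t, ∃ n : ℤ, (n : ℝ) = γ t k - δ t k := by
    intro t
    have h := congrFun ((hγc t).symm.trans (hδc t)) k
    have h0 : ((γ t k - δ t k : ℝ) : UnitAddCircle) = 0 := by
      rw [AddCircle.coe_sub, sub_eq_zero]
      exact h
    obtain ⟨n, hn⟩ := (AddCircle.coe_eq_zero_iff 1).mp h0
    exact ⟨n, by simpa using hn⟩
  choose f hf using hint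
  have hcont : Continuous f := by
    rw [Int.isClosedEmbedding_coe_real.isInducing.continuous_iff]
    have : (Int.cast ∘ f : ℝ → ℝ) = fun t ↦ γ t k - δ t k := funext hf
    rw [this]
    fun_prop
  have hconst : f 1 = f 0 := PreconnectedSpace.constant inferInstance hcont
  have h1 := congrFun (hγv 0) k
  have h2 := congrFun (hδw 0) k
  have h3 := hf 1
  have h4 := hf 0
  rw [hconst] at h3
  simp only [zero_add, Pi.add_apply] at h1 h2
  have : (v k : ℝ) = w k := by linarith
  exact_mod_cast this

theorem InducesOnHomology.comp {φ : X ≃ₜ Y} {χ : Y ≃ₜ Z} {A B : Matrix (Fin 2) (Fin 2) ℤ}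
    (hφ : InducesOnHomology τ τ' φ A) (hχ : InducesOnHomology τ' τ'' χ B) :
    InducesOnHomology τ τ'' (φ.trans χ) (B * A) := by
  intro c v hc
  have := hχ _ _ (hφ c v hc)
  rw [Matrix.mulVec_mulVec] at this
  exact this

theorem InducesOnHomology.pow {σ : X ≃ₜ X} {A : Matrix (Fin 2) (Fin 2) ℤ}
    (hσ : InducesOnHomology τ τ σ A) (n : ℕ) : InducesOnHomology τ τ (σ ^ n) (A ^ n) := by
  induction n with
  | zero =>
    intro c v hc
    rw [pow_zero, pow_zero, Matrix.one_mulVec]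
    exact hc
  | succ n ih =>
    rw [pow_succ, pow_succ]
    exact hσ.comp ih

/-- Equality of the slopes of `v` and `Φ x` means that these vectors are parallel. The cross product
expresses this without denominators and uniformly in the four cases of finite and infinite slopes.
-/
theorem cross_eq_zero_of_slopeOf_eq_act {Φ : Matrix.SpecialLinearGroup (Fin 2) ℚ}
    {v x : Fin 2 → ℤ} (hx : x ≠ 0) (h : slopeOf v = act Φ (slopeOf x)) :
    (Φ 0 0 * x 0 + Φ 0 1 * x 1) * v 1 = (Φ 1 0 * x 0 + Φ 1 1 * x 1) * v 0 := by
  have hne : ∀ w : Fin 2 → ℤ, w ≠ 0 → w 1 = 0 → (w 0 : ℚ) ≠ 0 := by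
    intro w hw h1 h0
    apply hw
    funext i
    fin_cases i
    · exact_mod_cast h0
    · exact h1
  unfold act slopeOf at h
  by_cases hx1 : x 1 = 0
  · have hx0 := hne x hx hx1
    rw [if_pos hx1, OnePoint.smul_infty_eq_ite] at h
    simp only [hx1, Int.cast_zero, mul_zero, add_zero]
    by_cases hv1 : v 1 = 0
    · rw [if_pos hv1] at h
      by_cases hc : Φ 1 0 = 0
      · simp [hc, hv1]
      · rw [if_neg (by simpa using hc)] at h
        exact absurd h (OnePoint.infty_ne_coe _)
    · rw [if_neg hv1] at h
      have hv1' : (v 1 : ℚ) ≠ 0 := by exact_mod_cast hv1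
      by_cases hc : Φ 1 0 = 0
      · rw [if_pos (by simpa using hc)] at h
        exact absurd h (OnePoint.coe_ne_infty _)
      · rw [if_neg (by simpa using hc)] at h
        have h' := OnePoint.coe_injective h
        simp only [Matrix.SpecialLinearGroup.coe_GL_coe_matrix] at h'
        field_simp at h'
        linear_combination (x 0 : ℚ) * (-h')
  · have hx1' : (x 1 : ℚ) ≠ 0 := by exact_mod_cast hx1
    rw [if_neg hx1, OnePoint.smul_some_eq_ite] at h
    by_cases hv1 : v 1 = 0
    · rw [if_pos hv1] at h
      by_cases hc : Φ 1 0 * ((x 0 : ℚ) / x 1) + Φ 1 1 = 0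
      · field_simp at hc
        rw [hv1, show Φ 1 0 * (x 0 : ℚ) + Φ 1 1 * x 1 = 0 by linear_combination hc]
        simp
      · rw [if_neg (by simpa using hc)] at h
        exact absurd h (OnePoint.infty_ne_coe _)
    · rw [if_neg hv1] at h
      have hv1' : (v 1 : ℚ) ≠ 0 := by exact_mod_cast hv1
      by_cases hc : Φ 1 0 * ((x 0 : ℚ) / x 1) + Φ 1 1 = 0
      · rw [if_pos (by simpa using hc)] at h
        exact absurd h (OnePoint.coe_ne_infty _)
      · rw [if_neg (by simpa using hc)] at h
        have h' := OnePoint.coe_injective h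
        simp only [Matrix.SpecialLinearGroup.coe_GL_coe_matrix] at h'
        rw [div_eq_div_iff hv1' hc] at h'
        field_simp at h'
        linear_combination -h'

/-- If `φ` acts on homology as `B` and `φ Φ` fixes a slope, then `B Φ` has a rational
eigenvector. -/
theorem exists_eigenvector_of_fixed_slope {φ : X ≃ₜ Y} {B : Matrix (Fin 2) (Fin 2) ℤ}
    (hφ : InducesOnHomology τ τ' φ B) {Φ : Matrix.SpecialLinearGroup (Fin 2) ℚ} {p : Slope}
    (h : MapsSlope τ τ' φ (act Φ p) p) :
    ∃ x : Fin 2 → ℚ, x ≠ 0 ∧ ∃ l : ℚ,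
      (B.map (Int.cast : ℤ → ℚ) * (Φ : Matrix (Fin 2) (Fin 2) ℚ)).mulVec x = l • x := by
  obtain ⟨c, ⟨-, v, hv0, hv, hvp⟩, ⟨-, x, hx0, hx, hxp⟩⟩ := h
  have hxv : x = B.mulVec v := hx.unique (hφ c v hv)
  have hcross := cross_eq_zero_of_slopeOf_eq_act hx0 (hxp.symm ▸ hvp)
  -- Here `v` is the class of the curve in `X` and `x = B v` that of its image. From `Φ x = l v` it
  -- follows that `B Φ x = l B v = l x`.
  have hpar : ∃ l : ℚ, (Φ : Matrix (Fin 2) (Fin 2) ℚ).mulVec (fun k ↦ (x k : ℚ)) =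
      l • fun k ↦ (v k : ℚ) := by
    by_cases h0 : v 0 = 0
    · have h1 : (v 1 : ℚ) ≠ 0 := by
        intro h1
        apply hv0
        funext i
        fin_cases i
        · exact h0
        · exact_mod_cast h1
      refine ⟨(Φ 1 0 * x 0 + Φ 1 1 * x 1) / v 1, ?_⟩
      funext i
      fin_cases i
      · have := hcross
        rw [h0, Int.cast_zero, mul_zero] at this
        simpa [Matrix.mulVec_fin_two, h0] using (mul_eq_zero.mp this).resolve_right h1
      · simp [Matrix.mulVec_fin_two, h1]
    · have h0' : (v 0 : ℚ) ≠ 0 := by exact_mod_cast h0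
      refine ⟨(Φ 0 0 * x 0 + Φ 0 1 * x 1) / v 0, ?_⟩
      funext i
      fin_cases i
      · simp [Matrix.mulVec_fin_two, h0']
      · simp only [Matrix.mulVec_fin_two, Fin.mk_one, Matrix.cons_val_one, Matrix.cons_val_zero,
          Pi.smul_apply, smul_eq_mul]
        field_simp
        linear_combination -hcross
  obtain ⟨l, hl⟩ := hpar
  refine ⟨fun k ↦ (x k : ℚ), ?_, l, ?_⟩
  · intro h
    apply hx0
    funext k
    have : (x k : ℚ) = 0 := congrFun h k
    exact_mod_cast this
  · rw [← Matrix.mulVec_mulVec, hl, Matrix.mulVec_smul]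
    congr 1
    funext k
    rw [hxv]
    simp [Matrix.mulVec, dotProduct]

/-- Extended distance in a graph is zero only between equal vertices. -/
theorem one_le_mapDistance {φ : X ≃ₜ Y} {Φ : Matrix.SpecialLinearGroup (Fin 2) ℚ}
    (h : ∀ p, ¬ MapsSlope τ τ' φ (act Φ p) p) : 1 ≤ mapDistance τ τ' φ Φ := by
  refine le_iInf fun p ↦ le_iInf fun q ↦ le_iInf fun hpq ↦ ?_
  rw [Order.one_le_iff_ne_zero, Ne, SimpleGraph.edist_eq_zero_iff]
  rintro rfl
  exact h p hpq

/-- For an Anosov map `σ`, the distance of `σ ^ n ψ Φ` is at least one for large `n`. -/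
theorem eventually_one_le_mapDistance {ψ : X ≃ₜ Y} (hψ : PreservesOrientation τ τ' ψ) {σ : Y ≃ₜ Y}
    (hσ : IsAnosov τ' σ) (Φ : Matrix.SpecialLinearGroup (Fin 2) ℚ) :
    ∃ N : ℕ, ∀ n, N ≤ n → 1 ≤ mapDistance τ τ' (ψ.trans (σ ^ n)) Φ := by
  obtain ⟨P, hP, hPdet⟩ := hψ
  obtain ⟨A, hA, hAdet, htr⟩ := hσ
  obtain ⟨N, hN⟩ := eventually_no_rational_eigenvector A P hAdet hPdet htr Φ Φ.2
  refine ⟨N, fun n hn ↦ one_le_mapDistance fun p hp ↦ ?_⟩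
  obtain ⟨x, hx, l, hl⟩ := exists_eigenvector_of_fixed_slope (hP.comp (hA.pow n)) hp
  exact hN n hn x hx l hl

end Slopes

/-! ### Normal isotopies and edge weights. -/

section Isotopy

/-- The number of points in which `K` meets the edge that the faces `a` and `b` share. -/
def edgeWeight (K : Set Tet) (a b : Fin 4) : ℕ := {x ∈ K | x a = 0 ∧ x b = 0}.ncard

theorem NormallyIsotopic.refl (K : Set Tet) : NormallyIsotopic K K :=
  ⟨⟨fun p ↦ p.2.1, by fun_prop⟩, fun _ ↦ Subtype.val_injective, fun _ ↦ rfl, by simp,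
    fun _ _ _ ↦ Iff.rfl⟩

/-- The end map is isolated as a bijection onto `K'`, so that a second isotopy can be precomposed
with it. -/
theorem NormallyIsotopic.exists_map {K K' : Set Tet} (h : NormallyIsotopic K K') :
    ∃ f : C(K, K'), Function.Bijective f ∧ (∀ x a, (f x).1 a = 0 ↔ x.1 a = 0) ∧
      ∃ H : C(unitInterval × K, Tet), (∀ t, Function.Injective fun x ↦ H (t, x)) ∧
        (∀ x, H (0, x) = x) ∧ (∀ x, H (1, x) = f x) ∧ ∀ t x a, H (t, x) a = 0 ↔ x.1 a = 0 := by
  obtain ⟨H, hinj, h0, h1, hz⟩ := h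
  have hmem : ∀ x, H (1, x) ∈ K' := fun x ↦ h1 ▸ Set.mem_range_self x
  refine ⟨⟨fun x ↦ ⟨H (1, x), hmem x⟩, by fun_prop⟩, ⟨fun x y hxy ↦ ?_, fun y ↦ ?_⟩,
    fun x a ↦ hz 1 x a, H, hinj, h0, fun _ ↦ rfl, hz⟩
  · exact hinj 1 (congrArg Subtype.val hxy)
  · have hy : y.1 ∈ Set.range fun x ↦ H (1, x) := by rw [h1]; exact y.2
    obtain ⟨x, hx⟩ := hy
    exact ⟨x, Subtype.ext hx⟩

theorem NormallyIsotopic.trans {K K' K'' : Set Tet} (h : NormallyIsotopic K K')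
    (h' : NormallyIsotopic K' K'') : NormallyIsotopic K K'' := by
  obtain ⟨f, hf, hfz, H, hinj, h0, h1, hz⟩ := h.exists_map
  obtain ⟨g, hg, hgz, H', hinj', h0', h1', hz'⟩ := h'.exists_map
  -- Both isotopies become homotopies through maps with the property `P`, which are known to
  -- concatenate.
  let P : C(K, Tet) → Prop := fun u ↦ Function.Injective u ∧ ∀ x a, u x a = 0 ↔ x.1 a = 0
  let i : C(K, Tet) := ⟨Subtype.val, continuous_subtype_val⟩
  let j : C(K, Tet) := ⟨fun x ↦ (f x).1, by fun_prop⟩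
  let k : C(K, Tet) := ⟨fun x ↦ (g (f x)).1, by fun_prop⟩
  let F : ContinuousMap.HomotopyWith i j P :=
    { toContinuousMap := H
      map_zero_left := h0
      map_one_left := h1
      prop' := fun t ↦ ⟨hinj t, hz t⟩ }
  let G : ContinuousMap.HomotopyWith j k P :=
    { toContinuousMap := ⟨fun p ↦ H' (p.1, f p.2), by fun_prop⟩
      map_zero_left := fun x ↦ h0' (f x)
      map_one_left := fun x ↦ h1' (f x)
      prop' := fun t ↦ ⟨(hinj' t).comp hf.1, fun x a ↦ (hz' t (f x) a).trans (hfz x a)⟩ }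
  let E := F.trans G
  refine ⟨E.toContinuousMap, fun t ↦ (E.prop t).1, E.apply_zero, ?_, fun t ↦ (E.prop t).2⟩
  have : (fun x ↦ E (1, x)) = fun x ↦ (g (f x)).1 := funext E.apply_one
  change Set.range (fun x ↦ E (1, x)) = K''
  rw [this]
  ext y
  constructor
  · rintro ⟨x, rfl⟩
    exact (g (f x)).2
  · intro hy
    obtain ⟨x, hx⟩ := (hg.comp hf).2 ⟨y, hy⟩
    exact ⟨x, congrArg Subtype.val hx⟩

theorem NormallyIsotopic.exists_homeomorph {K K' : Set Tet} (h : NormallyIsotopic K K')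
    (hK : IsCompact K) : ∃ f : K ≃ₜ K', ∀ x a, (f x).1 a = 0 ↔ x.1 a = 0 := by
  obtain ⟨f, hf, hz, -⟩ := h.exists_map
  have : CompactSpace K := isCompact_iff_compactSpace.mp hK
  exact ⟨Continuous.homeoOfEquivCompactToT2 (f := Equiv.ofBijective f hf) f.continuous, hz⟩

theorem NormallyIsotopic.isCompact {K K' : Set Tet} (h : NormallyIsotopic K K')
    (hK : IsCompact K) : IsCompact K' := by
  obtain ⟨f, -⟩ := h.exists_homeomorph hK
  have : CompactSpace K := isCompact_iff_compactSpace.mp hK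
  exact isCompact_iff_compactSpace.mpr f.compactSpace

/-- The isotopy of the union restricts to each part, and injectivity at time `1` keeps the images
disjoint. In this way two disjoint curves are straightened simultaneously. -/
theorem NormallyIsotopic.exists_disjoint_images {L L' K : Set Tet}
    (h : NormallyIsotopic (L ∪ L') K) (hd : Disjoint L L') :
    ∃ X Y, NormallyIsotopic L X ∧ NormallyIsotopic L' Y ∧ Disjoint X Y ∧ X ∪ Y = K := by
  obtain ⟨H, hinj, h0, h1, hz⟩ := h
  let i : L → ↥(L ∪ L') := Set.inclusion Set.subset_union_left
  let j : L' → ↥(L ∪ L') := Set.inclusion Set.subset_union_right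
  have hi : Continuous i := continuous_inclusion _
  have hj : Continuous j := continuous_inclusion _
  refine ⟨Set.range fun x ↦ H (1, i x), Set.range fun x ↦ H (1, j x), ?_, ?_, ?_, ?_⟩
  · exact ⟨⟨fun p ↦ H (p.1, i p.2), by fun_prop⟩,
      fun t ↦ (hinj t).comp (Set.inclusion_injective _), fun x ↦ h0 (i x), rfl,
      fun t x a ↦ hz t (i x) a⟩
  · exact ⟨⟨fun p ↦ H (p.1, j p.2), by fun_prop⟩,
      fun t ↦ (hinj t).comp (Set.inclusion_injective _), fun x ↦ h0 (j x), rfl,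
      fun t x a ↦ hz t (j x) a⟩
  · rw [Set.disjoint_left]
    rintro _ ⟨x, rfl⟩ ⟨y, hy⟩
    have hxy : j y = i x := hinj 1 hy
    have : y.1 = x.1 := congrArg Subtype.val hxy
    exact Set.disjoint_left.mp hd x.2 (this ▸ y.2)
  · rw [← h1]
    ext z
    constructor
    · rintro (⟨x, rfl⟩ | ⟨x, rfl⟩)
      exacts [⟨i x, rfl⟩, ⟨j x, rfl⟩]
    · rintro ⟨⟨x, hx | hx⟩, rfl⟩
      exacts [Or.inl ⟨⟨x, hx⟩, rfl⟩, Or.inr ⟨⟨x, hx⟩, rfl⟩]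

theorem edgeWeight_eq_of_bijOn {K K' : Set Tet} {f : Tet → Tet} (hf : Set.BijOn f K K')
    (hz : ∀ x ∈ K, ∀ a, f x a = 0 ↔ x a = 0) (a b : Fin 4) :
    edgeWeight K a b = edgeWeight K' a b := by
  have himg : {x ∈ K' | x a = 0 ∧ x b = 0} = f '' {x ∈ K | x a = 0 ∧ x b = 0} := by
    ext y
    constructor
    · rintro ⟨hy, h⟩
      obtain ⟨x, hx, rfl⟩ := hf.surjOn hy
      exact ⟨x, ⟨hx, (hz x hx a).mp h.1, (hz x hx b).mp h.2⟩, rfl⟩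
    · rintro ⟨x, ⟨hx, h⟩, rfl⟩
      exact ⟨hf.mapsTo hx, (hz x hx a).mpr h.1, (hz x hx b).mpr h.2⟩
  rw [edgeWeight, edgeWeight, himg]
  exact (Set.InjOn.ncard_image (hf.injOn.mono fun x hx ↦ hx.1)).symm

/-- Homeomorphisms that preserve the faces preserve the edge weights of loops. -/
theorem exists_loop_of_homeomorph {K K' : Set Tet} (f : K ≃ₜ K')
    (hf : ∀ x a, (f x).1 a = 0 ↔ x.1 a = 0) {L : Set Tet} (hL : L ∈ loops K) :
    ∃ L' ∈ loops K', edgeWeight L = edgeWeight L' := by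
  obtain ⟨x, hx, rfl⟩ := hL
  refine ⟨connectedComponentIn K' (f ⟨x, hx⟩), ⟨_, (f ⟨x, hx⟩).2, rfl⟩, ?_⟩
  classical
  let g : Tet → Tet := fun y ↦ if hy : y ∈ K then f ⟨y, hy⟩ else y
  have hg : ∀ y : K, g y = f y := fun y ↦ by simp [g]
  rw [connectedComponentIn_eq_image hx, connectedComponentIn_eq_image (f ⟨x, hx⟩).2]
  funext a b
  have himg : f '' connectedComponent ⟨x, hx⟩ = connectedComponent (f ⟨x, hx⟩) := by
    simp only [← connectedComponentIn_univ]
    rw [f.image_connectedComponentIn (Set.mem_univ _), Set.image_univ, f.surjective.range_eq]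
  refine edgeWeight_eq_of_bijOn (f := g) ⟨?_, ?_, ?_⟩ ?_ a b
  · rintro _ ⟨y, hy, rfl⟩
    rw [hg]
    exact ⟨f y, himg ▸ Set.mem_image_of_mem f hy, rfl⟩
  · rintro _ ⟨y, -, rfl⟩ _ ⟨z, -, rfl⟩ h
    rw [hg, hg] at h
    rw [f.injective (Subtype.ext h)]
  · rintro _ ⟨y, hy, rfl⟩
    rw [← himg] at hy
    obtain ⟨z, hz, rfl⟩ := hy
    exact ⟨z.1, ⟨z, hz, rfl⟩, hg z⟩
  · rintro _ ⟨y, -, rfl⟩ a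
    rw [hg]
    exact hf y a

end Isotopy

/-! ### Loops, their arcs and their lengths. -/

section Loops

/-- `K` meets the face `a` in finitely many disjoint closed connected sets, each of which meets
each of the other faces in at most one point. -/
def IsArcwise (K : Set Tet) : Prop :=
  K ⊆ tetBoundary ∧ ∀ a, ∃ 𝒜 : Set (Set Tet), 𝒜.Finite ∧ 𝒜.PairwiseDisjoint id ∧
    K ∩ face a = ⋃₀ 𝒜 ∧ ∀ A ∈ 𝒜, IsClosed A ∧ IsPreconnected A ∧
      ∀ b, b ≠ a → {x ∈ A | x b = 0}.Subsingleton

theorem IsPreconnected.subset_of_finite_closed_cover {X : Type*} [TopologicalSpace X] {S : Set X}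
    (hS : IsPreconnected S) {𝒜 : Set (Set X)} (hfin : 𝒜.Finite) (hd : 𝒜.PairwiseDisjoint id)
    (hc : ∀ A ∈ 𝒜, IsClosed A) (hcov : S ⊆ ⋃₀ 𝒜) {A : Set X} (hA : A ∈ 𝒜) {x : X} (hxS : x ∈ S)
    (hxA : x ∈ A) : S ⊆ A := by
  have hB : IsClosed (⋃₀ (𝒜 \ {A})) := by
    rw [Set.sUnion_eq_biUnion]
    exact (hfin.subset Set.sdiff_subset).isClosed_biUnion fun B hB ↦ hc B hB.1
  have hdis : Disjoint A (⋃₀ (𝒜 \ {A})) := by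
    rw [Set.disjoint_sUnion_right]
    intro B hB
    exact hd hA hB.1 (Ne.symm hB.2)
  have hsub : S ⊆ A ∪ ⋃₀ (𝒜 \ {A}) := by
    intro y hy
    obtain ⟨B, hB, hyB⟩ := hcov hy
    by_cases h : B = A
    · exact Or.inl (h ▸ hyB)
    · exact Or.inr ⟨B, ⟨hB, h⟩, hyB⟩
  rcases (isPreconnected_iff_subset_of_disjoint_closed.mp hS) A _ (hc A hA) hB hsub
    (by rw [hdis.inter_eq, Set.inter_empty]) with h | h
  · exact h
  · exact absurd (h hxS) (Set.disjoint_left.mp hdis hxA)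

theorem loops_eq_of_mem {K L : Set Tet} (hL : L ∈ loops K) {x : Tet} (hx : x ∈ L) :
    L = connectedComponentIn K x := by
  obtain ⟨y, hy, rfl⟩ := hL
  exact (connectedComponentIn_eq hx)

theorem loops_subset {K L : Set Tet} (hL : L ∈ loops K) : L ⊆ K := by
  obtain ⟨y, hy, rfl⟩ := hL
  exact connectedComponentIn_subset K y

theorem IsPreconnected.subset_loop {K L A : Set Tet} (hA : IsPreconnected A) (hAK : A ⊆ K)
    (hL : L ∈ loops K) {x : Tet} (hxA : x ∈ A) (hxL : x ∈ L) : A ⊆ L := by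
  rw [loops_eq_of_mem hL hxL]
  exact hA.subset_connectedComponentIn hxA hAK

/-- An arc in the face `a` has at most one point on the edge shared with `b`, so the points of `L`
on this edge inject into the arcs of `L` in `a`. -/
theorem IsArcwise.edgeWeight_le_loopLength {K L : Set Tet} (hK : IsArcwise K) (hL : L ∈ loops K)
    {a b : Fin 4} (hab : a ≠ b) : edgeWeight L a b ≤ loopLength L := by
  obtain ⟨𝒜, hfin, hd, hcov, h𝒜⟩ := hK.2 a
  have hLK : L ∩ face a ⊆ ⋃₀ 𝒜 := hcov ▸ Set.inter_subset_inter_left _ (loops_subset hL)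
  -- The components of `L ∩ face a` are members of `𝒜`: a component cannot leave its member because
  -- the family is finite, closed and disjoint, and a member that meets the loop lies in it by
  -- connectedness.
  have hcomp : ∀ A ∈ 𝒜, ∀ x ∈ A, x ∈ L → connectedComponentIn (L ∩ face a) x = A := by
    intro A hA x hxA hxL
    have hAK : A ⊆ K ∩ face a := hcov ▸ Set.subset_sUnion_of_mem hA
    have hxF : x ∈ L ∩ face a := ⟨hxL, (hAK hxA).2⟩
    apply subset_antisymm
    · exact IsPreconnected.subset_of_finite_closed_cover isPreconnected_connectedComponentIn hfin hd
        (fun B hB ↦ (h𝒜 B hB).1) ((connectedComponentIn_subset _ _).trans hLK) hA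
        (mem_connectedComponentIn hxF) hxA
    · exact (h𝒜 A hA).2.1.subset_connectedComponentIn hxA
        (Set.subset_inter (IsPreconnected.subset_loop (h𝒜 A hA).2.1
          (hAK.trans Set.inter_subset_left) hL hxA hxL) (hAK.trans Set.inter_subset_right))
  have harcs : arcs L a ⊆ 𝒜 := by
    rintro _ ⟨x, hx, rfl⟩
    obtain ⟨A, hA, hxA⟩ := hLK hx
    rw [hcomp A hA x hxA hx.1]
    exact hA
  calc edgeWeight L a b ≤ (arcs L a).ncard := by
        refine Set.ncard_le_ncard_of_injOn (fun x ↦ connectedComponentIn (L ∩ face a) x) ?_ ?_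
          (hfin.subset harcs)
        · rintro x ⟨hxL, hxa, -⟩
          exact ⟨x, ⟨hxL, hxa⟩, rfl⟩
        · rintro x ⟨hxL, hxa, hxb⟩ y ⟨hyL, hya, hyb⟩ hxy
          obtain ⟨A, hA, hxA⟩ := hLK ⟨hxL, hxa⟩
          have hyA : y ∈ A := by
            rw [← hcomp A hA x hxA hxL]
            change connectedComponentIn (L ∩ face a) x = connectedComponentIn (L ∩ face a) y at hxy
            rw [hxy]
            exact mem_connectedComponentIn ⟨hyL, hya⟩
          exact (h𝒜 A hA).2.2 b hab.symm ⟨hxA, hxb⟩ ⟨hyA, hyb⟩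
    _ ≤ loopLength L := Finset.single_le_sum (f := fun a ↦ (arcs L a).ncard)
        (fun _ _ ↦ Nat.zero_le _) (Finset.mem_univ a)

/-- Each loop contains one of the finitely many arcs, and an arc determines the loop that contains
it. -/
theorem IsArcwise.finite_loops {K : Set Tet} (hK : IsArcwise K) : (loops K).Finite := by
  choose 𝒜 hfin hd hcov h𝒜 using hK.2
  have : (⋃ a, 𝒜 a).Finite := Set.finite_iUnion hfin
  refine (this.image fun A ↦ {z | ∃ x ∈ A, z ∈ connectedComponentIn K x}).subset ?_
  rintro _ ⟨x, hx, rfl⟩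
  obtain ⟨a, ha⟩ := hK.1 hx
  have hxa : x ∈ K ∩ face a := ⟨hx, ha⟩
  rw [hcov] at hxa
  obtain ⟨A, hA, hxA⟩ := hxa
  refine ⟨A, Set.mem_iUnion_of_mem a hA, ?_⟩
  have hAK : A ⊆ K := fun y hy ↦ ((hcov a).symm ▸ Set.mem_sUnion_of_mem hy hA : y ∈ K ∩ face a).1
  ext z
  constructor
  · rintro ⟨y, hy, hz⟩
    rwa [connectedComponentIn_eq ((h𝒜 a A hA).2.1.subset_connectedComponentIn hxA hAK hy)]
  · exact fun hz ↦ ⟨x, hxA, hz⟩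

theorem IsArcwise.finite_edge {K : Set Tet} (hK : IsArcwise K) {a b : Fin 4} (hab : a ≠ b) :
    {x ∈ K | x a = 0 ∧ x b = 0}.Finite := by
  obtain ⟨𝒜, hfin, hd, hcov, h𝒜⟩ := hK.2 a
  refine (hfin.biUnion fun A hA ↦ ((h𝒜 A hA).2.2 b hab.symm).finite).subset ?_
  rintro x ⟨hx, hxa, hxb⟩
  have hxF : x ∈ K ∩ face a := ⟨hx, hxa⟩
  rw [hcov] at hxF
  obtain ⟨A, hA, hxA⟩ := hxF
  exact Set.mem_biUnion hA ⟨hxA, hxb⟩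

theorem IsArcwise.sum_edgeWeight_loops {K : Set Tet} (hK : IsArcwise K) {a b : Fin 4}
    (hab : a ≠ b) : ∑ L ∈ hK.finite_loops.toFinset, edgeWeight L a b = edgeWeight K a b := by
  classical
  have hfin := hK.finite_edge hab
  have hfinL : ∀ L ∈ loops K, {x ∈ L | x a = 0 ∧ x b = 0}.Finite := fun L hL ↦
    hfin.subset fun x hx ↦ ⟨loops_subset hL hx.1, hx.2⟩
  have hU : {x ∈ K | x a = 0 ∧ x b = 0} = ⋃ L ∈ loops K, {x ∈ L | x a = 0 ∧ x b = 0} := by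
    ext x
    simp only [Set.mem_iUnion, Set.mem_ofPred_eq, exists_prop]
    constructor
    · rintro ⟨hx, h⟩
      exact ⟨_, ⟨x, hx, rfl⟩, mem_connectedComponentIn hx, h⟩
    · rintro ⟨L, hL, hx, h⟩
      exact ⟨loops_subset hL hx, h⟩
  rw [edgeWeight, hU, hK.finite_loops.ncard_biUnion hfinL]
  · rw [finsum_mem_eq_finite_toFinset_sum _ hK.finite_loops]
    rfl
  · intro L hL L' hL' hne
    refine Set.disjoint_left.mpr fun x hx hx' ↦ hne ?_
    rw [loops_eq_of_mem hL hx.1, loops_eq_of_mem hL' hx'.1]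

/-- Unlike straightness, this property survives homeomorphisms that preserve the faces; it therefore
passes from straight curves to all compact normal curves. -/
theorem IsArcwise.of_homeomorph {K K' : Set Tet} (hK' : IsArcwise K') (hK : IsCompact K)
    (f : K ≃ₜ K') (hf : ∀ x a, (f x).1 a = 0 ↔ x.1 a = 0) : IsArcwise K := by
  have : CompactSpace K := isCompact_iff_compactSpace.mp hK
  refine ⟨fun x hx ↦ ?_, fun a ↦ ?_⟩
  · obtain ⟨a, ha⟩ := hK'.1 (f ⟨x, hx⟩).2
    exact ⟨a, (hf _ a).mp ha⟩
  · obtain ⟨𝒜, hfin, hd, hcov, h𝒜⟩ := hK'.2 a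
    have hsub : ∀ A ∈ 𝒜, A ⊆ K' := fun A hA y hy ↦
      (hcov.symm ▸ Set.mem_sUnion_of_mem hy hA : y ∈ K' ∩ face a).1
    let pull : Set Tet → Set Tet := fun A ↦ Subtype.val '' (f ⁻¹' (Subtype.val ⁻¹' A))
    refine ⟨pull '' 𝒜, hfin.image _, ?_, ?_, ?_⟩
    · rintro _ ⟨A, hA, rfl⟩ _ ⟨B, hB, rfl⟩ hne
      refine Set.disjoint_left.mpr ?_
      rintro _ ⟨x, hx, rfl⟩ ⟨y, hy, hxy⟩
      obtain rfl := Subtype.ext hxy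
      exact Set.disjoint_left.mp (hd hA hB fun h ↦ hne (congrArg pull h)) hx hy
    · ext x
      constructor
      · rintro ⟨hx, hxa⟩
        have : (f ⟨x, hx⟩).1 ∈ K' ∩ face a := ⟨(f ⟨x, hx⟩).2, (hf _ a).mpr hxa⟩
        rw [hcov] at this
        obtain ⟨A, hA, hxA⟩ := this
        exact ⟨_, ⟨A, hA, rfl⟩, ⟨x, hx⟩, hxA, rfl⟩
      · rintro ⟨_, ⟨A, hA, rfl⟩, ⟨x, hxA, rfl⟩⟩
        have : (f x).1 ∈ K' ∩ face a := hcov.symm ▸ Set.mem_sUnion_of_mem hxA hA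
        exact ⟨x.2, (hf x a).mp this.2⟩
    · rintro _ ⟨A, hA, rfl⟩
      obtain ⟨h1, h2, h3⟩ := h𝒜 A hA
      refine ⟨?_, ?_, ?_⟩
      · exact (((h1.preimage continuous_subtype_val).preimage f.continuous).isCompact.image
          continuous_subtype_val).isClosed
      · have h2' : IsPreconnected (Subtype.val ⁻¹' A : Set K') := by
          rw [← Topology.IsInducing.subtypeVal.isPreconnected_image, Subtype.image_preimage_coe,
            Set.inter_eq_right.mpr (hsub A hA)]
          exact h2
        exact (f.isPreconnected_preimage.mpr h2').image _ continuous_subtype_val.continuousOn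
      · rintro b hb _ ⟨⟨x, hx, rfl⟩, hxb⟩ _ ⟨⟨y, hy, rfl⟩, hyb⟩
        have := h3 b hb ⟨hx, (hf x b).mpr hxb⟩ ⟨hy, (hf y b).mpr hyb⟩
        rw [f.injective (Subtype.ext this)]

end Loops

/-! ### Straight arcs in a triangle and when they are disjoint. -/

section Segments

/-- The straight segment from `p` to `q` in the tetrahedron. -/
def seg (p q : Tet) : Set Tet := {x | x.1 ∈ segment ℝ p.1 q.1}

theorem mem_seg_iff {p q x : Tet} :
    x ∈ seg p q ↔ ∃ s : ℝ, 0 ≤ s ∧ s ≤ 1 ∧ ∀ k, x k = (1 - s) * p k + s * q k := by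
  constructor
  · rintro ⟨u, s, hu, hs, hus, h⟩
    obtain rfl : u = 1 - s := by linarith
    exact ⟨s, hs, by linarith, fun k ↦ (congrFun h k).symm⟩
  · rintro ⟨s, hs, hs', h⟩
    exact ⟨1 - s, s, by linarith, hs, by ring, funext fun k ↦ (h k).symm⟩

theorem seg_comm (p q : Tet) : seg p q = seg q p := by
  unfold seg
  rw [segment_symm]

theorem left_mem_seg (p q : Tet) : p ∈ seg p q := left_mem_segment ℝ p.1 q.1

theorem right_mem_seg (p q : Tet) : q ∈ seg p q := right_mem_segment ℝ p.1 q.1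

theorem tet_ext {p q : Tet} (h : ∀ k, p k = q k) : p = q := Subtype.ext (funext h)

theorem tet_nonneg (p : Tet) (k : Fin 4) : 0 ≤ p k := p.2.1 k

/-- The point that divides the segment from `p` to `q` in the ratio `s : 1 - s`. -/
def segPoint (p q : Tet) (s : unitInterval) : Tet :=
  ⟨(1 - s.1) • p.1 + s.1 • q.1, (convex_stdSimplex ℝ (Fin 4)) p.2 q.2 (sub_nonneg.mpr s.2.2) s.2.1
    (by ring)⟩

theorem segPoint_apply (p q : Tet) (s : unitInterval) (k : Fin 4) :
    segPoint p q s k = (1 - s.1) * p k + s.1 * q k := rfl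

theorem continuous_segPoint (p q : Tet) : Continuous (segPoint p q) := by
  unfold segPoint
  fun_prop

theorem seg_eq_range (p q : Tet) : seg p q = Set.range (segPoint p q) := by
  ext x
  rw [mem_seg_iff]
  constructor
  · rintro ⟨s, h0, h1, h⟩
    exact ⟨⟨s, h0, h1⟩, tet_ext fun k ↦ (h k).symm⟩
  · rintro ⟨s, rfl⟩
    exact ⟨s, s.2.1, s.2.2, fun k ↦ rfl⟩

theorem isCompact_seg (p q : Tet) : IsCompact (seg p q) :=
  seg_eq_range p q ▸ isCompact_range (continuous_segPoint p q)

theorem isPreconnected_seg (p q : Tet) : IsPreconnected (seg p q) :=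
  seg_eq_range p q ▸ isPreconnected_range (continuous_segPoint p q)

theorem segment_apply_zero {p q x : Tet} (hx : x ∈ seg p q) {a : Fin 4} (hp : p a = 0)
    (hq : q a = 0) : x a = 0 := by
  obtain ⟨s, -, -, h⟩ := mem_seg_iff.mp hx
  rw [h, hp, hq]
  ring

/-- `p` is an interior point of the edge that the faces `a` and `b` share. -/
def IsEdgePoint (a b : Fin 4) (p : Tet) : Prop := ∀ k, p k = 0 ↔ k = a ∨ k = b

theorem IsEdgePoint.zero_left {a b : Fin 4} {p : Tet} (h : IsEdgePoint a b p) : p a = 0 :=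
  (h a).mpr (Or.inl rfl)

theorem IsEdgePoint.zero_right {a b : Fin 4} {p : Tet} (h : IsEdgePoint a b p) : p b = 0 :=
  (h b).mpr (Or.inr rfl)

theorem IsEdgePoint.pos {a b k : Fin 4} {p : Tet} (h : IsEdgePoint a b p) (ha : k ≠ a)
    (hb : k ≠ b) : 0 < p k :=
  (tet_nonneg p k).lt_of_ne' fun h0 ↦ ((h k).mp h0).elim ha hb

theorem exists_fourth : ∀ a b b' : Fin 4, a ≠ b → a ≠ b' → b ≠ b' →
    ∃ c, c ≠ a ∧ c ≠ b ∧ c ≠ b' ∧ ∀ k, k = a ∨ k = b ∨ k = b' ∨ k = c := by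
  decide

theorem sum_four (f : Fin 4 → ℝ) : ∀ a b b' c : Fin 4, a ≠ b → a ≠ b' → b ≠ b' → c ≠ a → c ≠ b →
    c ≠ b' → f a + f b + f b' + f c = ∑ k, f k := by
  intro a b b' c h1 h2 h3 h4 h5 h6
  have : (Finset.univ : Finset (Fin 4)) = {a, b, b', c} := by
    symm
    rw [← Finset.card_eq_iff_eq_univ, Fintype.card_fin]
    rw [Finset.card_insert_of_notMem, Finset.card_insert_of_notMem, Finset.card_insert_of_notMem,
      Finset.card_singleton] <;> simp <;> tauto
  rw [this, Finset.sum_insert, Finset.sum_insert, Finset.sum_insert, Finset.sum_singleton]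
  · ring
  all_goals simp
  all_goals tauto

/-- The vertices of a triangle in the face `a`: the corner `c` and the two others. -/
structure FaceFrame (a b b' c : Fin 4) : Prop where
  hab : a ≠ b
  hab' : a ≠ b'
  hbb' : b ≠ b'
  hca : c ≠ a
  hcb : c ≠ b
  hcb' : c ≠ b'

theorem FaceFrame.cases {a b b' c : Fin 4} (h : FaceFrame a b b' c) (k : Fin 4) :
    k = a ∨ k = b ∨ k = b' ∨ k = c := by
  obtain ⟨d, -, -, -, hd⟩ := exists_fourth a b b' h.hab h.hab' h.hbb'
  have hc := hd c
  have := h.hca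
  have := h.hcb
  have := h.hcb'
  have hk := hd k
  grind

theorem FaceFrame.symm {a b b' c : Fin 4} (h : FaceFrame a b b' c) : FaceFrame a b' b c :=
  ⟨h.hab', h.hab, h.hbb'.symm, h.hca, h.hcb', h.hcb⟩

theorem FaceFrame.sum {a b b' c : Fin 4} (h : FaceFrame a b b' c) {x : Tet} (hx : x a = 0) :
    x b + x b' + x c = 1 := by
  have h1 := sum_four x a b b' c h.hab h.hab' h.hbb' h.hca h.hcb h.hcb'
  have h2 : ∑ k, x k = 1 := x.2.2
  rw [hx] at h1
  linarith

theorem exists_faceFrame {a b b' : Fin 4} (hab : b ≠ a) (hab' : b' ≠ a) (hbb' : b ≠ b') :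
    ∃ c, FaceFrame a b b' c := by
  obtain ⟨c, h1, h2, h3, -⟩ := exists_fourth a b b' hab.symm hab'.symm hbb'
  exact ⟨c, hab.symm, hab'.symm, hbb', h1, h2, h3⟩

theorem IsEdgePoint.ext {a b c : Fin 4} {x y : Tet} {b' : Fin 4} (F : FaceFrame a b b' c)
    (hx : IsEdgePoint a b x) (hy : IsEdgePoint a b y) (h : x c = y c) : x = y := by
  refine tet_ext fun k ↦ ?_
  have h1 := F.sum hx.zero_left
  have h2 := F.sum hy.zero_left
  rw [hx.zero_right] at h1
  rw [hy.zero_right] at h2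
  rcases F.cases k with rfl | rfl | rfl | rfl
  · rw [hx.zero_left, hy.zero_left]
  · rw [hx.zero_right, hy.zero_right]
  · linarith
  · exact h

/-- At an interior point of the arc a coordinate vanishes only if it vanishes at both endpoints, and
the only such coordinate is `a`. -/
theorem eq_endpoint_of_mem_seg {a b b' : Fin 4} {p q x : Tet} (hbb' : b ≠ b')
    (hp : IsEdgePoint a b p) (hq : IsEdgePoint a b' q) (hx : x ∈ seg p q) {k : Fin 4} (hk : k ≠ a)
    (hxk : x k = 0) : x = p ∨ x = q := by
  obtain ⟨s, h0, h1, h⟩ := mem_seg_iff.mp hx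
  rw [h k] at hxk
  have h2 := mul_nonneg (sub_nonneg.mpr h1) (tet_nonneg p k)
  have h3 := mul_nonneg h0 (tet_nonneg q k)
  have h4 : (1 - s) * p k = 0 := by linarith
  have h5 : s * q k = 0 := by linarith
  rcases mul_eq_zero.mp h5 with hs | hs
  · left
    refine tet_ext fun j ↦ ?_
    rw [h j, hs]
    ring
  · rcases mul_eq_zero.mp h4 with hs' | hs'
    · right
      obtain rfl : s = 1 := by linarith
      refine tet_ext fun j ↦ ?_
      rw [h j]
      ring
    · rw [hp] at hs'
      rw [hq] at hs
      grind

/-- The affine functional on the face `a` that vanishes on the normal arc from `p` to `q` and is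
positive at the corner `c` that the arc cuts off. -/
def side (b b' c : Fin 4) (p q x : Tet) : ℝ := x c - p c / p b' * x b' - q c / q b * x b

theorem side_of_combination {b b' c : Fin 4} {p q x y z : Tet} {s : ℝ}
    (h : ∀ k, x k = (1 - s) * y k + s * z k) :
    side b b' c p q x = (1 - s) * side b b' c p q y + s * side b b' c p q z := by
  unfold side
  rw [h, h, h]
  ring

section Frame

variable {a b b' c : Fin 4} (F : FaceFrame a b b' c) {p q : Tet} (hp : IsEdgePoint a b p)
  (hq : IsEdgePoint a b' q)

include F hp hq

theorem mem_seg_iff_side {x : Tet} (hx : x a = 0) : x ∈ seg p q ↔ side b b' c p q x = 0 := by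
  have hpb := hp.pos F.hab'.symm F.hbb'.symm
  have hqb := hq.pos F.hab.symm F.hbb'
  have hps := F.sum hp.zero_left
  have hqs := F.sum hq.zero_left
  have hxs := F.sum hx
  rw [hp.zero_right] at hps
  rw [hq.zero_right] at hqs
  unfold side
  constructor
  · intro h
    obtain ⟨s, -, -, h⟩ := mem_seg_iff.mp h
    rw [h, h, h, hp.zero_right, hq.zero_right]
    field_simp
    ring
  · intro h
    have h1 : x c = p c * (x b' / p b') + q c * (x b / q b) := by linear_combination h
    have h2 : x b' = p b' * (x b' / p b') := by field_simp
    have h3 : x b = q b * (x b / q b) := by field_simp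
    have h4 : x b' / p b' + x b / q b = 1 := by
      rw [h1, h2, h3] at hxs
      simp only [mul_div_cancel_left₀ _ hpb.ne', mul_div_cancel_left₀ _ hqb.ne'] at hxs
      linear_combination hxs - (x b' / p b') * hps - (x b / q b) * hqs
    -- The endpoint `q` alone contributes to the coordinate `b`, and `p` alone to `b'`; this
    -- determines the two weights, whose sum is `1` by `h4`.
    refine mem_seg_iff.mpr ⟨x b / q b, div_nonneg (tet_nonneg _ _) hqb.le, ?_, fun k ↦ ?_⟩
    · have := div_nonneg (tet_nonneg x b') hpb.le
      linarith
    · have h5 : 1 - x b / q b = x b' / p b' := by linarith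
      rw [h5]
      rcases F.cases k with rfl | rfl | rfl | rfl
      · rw [hx, hp.zero_left, hq.zero_left]
        ring
      · rw [hp.zero_right]
        linear_combination h3
      · rw [hq.zero_right]
        linear_combination h2
      · linear_combination h1

/-- The function `side` is affine along the segment from `y` to `z`, so it has no zero there exactly
if its values at the endpoints have the same strict sign. -/
theorem disjoint_seg_iff_side {y z : Tet} (hy : y a = 0) (hz : z a = 0) :
    Disjoint (seg p q) (seg y z) ↔ 0 < side b b' c p q y * side b b' c p q z := by
  constructor
  · intro h
    by_contra! hle
    by_cases h0 : side b b' c p q y = 0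
    · exact Set.disjoint_left.mp h ((mem_seg_iff_side F hp hq hy).mpr h0) (left_mem_seg y z)
    · have hne : side b b' c p q y - side b b' c p q z ≠ 0 := by
        intro h1
        have h2 := sub_eq_zero.mp h1
        rw [← h2] at hle
        exact absurd hle (not_le.mpr (mul_self_pos.mpr h0))
      -- The quotient is the parameter at which the affine function vanishes.
      have hs0 : 0 ≤ side b b' c p q y / (side b b' c p q y - side b b' c p q z) := by
        rcases lt_or_gt_of_ne h0 with h1 | h1
        · exact div_nonneg_of_nonpos h1.le (by nlinarith)
        · exact div_nonneg h1.le (by nlinarith)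
      have hs1 : side b b' c p q y / (side b b' c p q y - side b b' c p q z) ≤ 1 := by
        rcases lt_or_gt_of_ne h0 with h1 | h1
        · rw [div_le_one_of_neg (lt_of_le_of_ne (by nlinarith) hne)]
          nlinarith
        · rw [div_le_one (lt_of_le_of_ne (by nlinarith) hne.symm)]
          nlinarith
      let x := segPoint y z ⟨_, hs0, hs1⟩
      have hx : x ∈ seg y z := seg_eq_range y z ▸ Set.mem_range_self _
      refine Set.disjoint_left.mp h ((mem_seg_iff_side F hp hq (segment_apply_zero hx hy hz)).mpr ?_)
        hx
      rw [side_of_combination (segPoint_apply y z _)]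
      simp only
      field_simp
      ring
  · intro h
    refine Set.disjoint_left.mpr fun x hx hx' ↦ ?_
    rw [mem_seg_iff_side F hp hq (segment_apply_zero hx' hy hz)] at hx
    obtain ⟨s, h0, h1, hs⟩ := mem_seg_iff.mp hx'
    rw [side_of_combination hs] at hx
    rcases pos_and_pos_or_neg_and_neg_of_mul_pos h with ⟨hy, hz⟩ | ⟨hy, hz⟩
    · rcases eq_or_lt_of_le h0 with rfl | h0
      · linarith
      · nlinarith [mul_pos h0 hz, mul_nonneg (sub_nonneg.mpr h1) hy.le]
    · rcases eq_or_lt_of_le h0 with rfl | h0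
      · linarith
      · nlinarith [mul_neg_of_pos_of_neg h0 hz,
          mul_nonpos_of_nonneg_of_nonpos (sub_nonneg.mpr h1) hy.le]

omit hq in
-- On the edge that contains `p`, the function `side` is a positive multiple of the displacement
-- from `p` towards `c`. Its sign thus records the order of points on that edge.
theorem side_of_left {y : Tet} (hy : IsEdgePoint a b y) :
    side b b' c p q y * p b' = y c - p c := by
  have hpb := hp.pos F.hab'.symm F.hbb'.symm
  have hps := F.sum hp.zero_left
  have hys := F.sum hy.zero_left
  rw [hp.zero_right] at hps
  rw [hy.zero_right] at hys
  unfold side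
  rw [hy.zero_right]
  field_simp
  linear_combination y c * hps - p c * hys

omit hp in
theorem side_of_right {y : Tet} (hy : IsEdgePoint a b' y) :
    side b b' c p q y * q b = y c - q c := by
  have hqb := hq.pos F.hab.symm F.hbb'
  have hqs := F.sum hq.zero_left
  have hys := F.sum hy.zero_left
  rw [hq.zero_right] at hqs
  rw [hy.zero_right] at hys
  unfold side
  rw [hy.zero_right]
  field_simp
  linear_combination y c * hqs - q c * hys

/-- The edge opposite to the corner `c` lies entirely beyond the arc, so no order comparison is
needed there. -/
theorem side_of_opposite {y : Tet} (hy : IsEdgePoint a c y) : side b b' c p q y < 0 := by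
  have hpb := hp.pos F.hab'.symm F.hbb'.symm
  have hqb := hq.pos F.hab.symm F.hbb'
  have h1 := hy.pos F.hab.symm F.hcb.symm
  have h2 := hy.pos F.hab'.symm F.hcb'.symm
  have h3 := hp.pos F.hca F.hcb
  have h4 := hq.pos F.hca F.hcb'
  unfold side
  rw [hy.zero_right]
  have := mul_pos (div_pos h3 hpb) h2
  have := mul_pos (div_pos h4 hqb) h1
  linarith

omit hq in
theorem side_pos_iff_of_left {y : Tet} (hy : IsEdgePoint a b y) :
    0 < side b b' c p q y ↔ p c < y c := by
  have hpb := hp.pos F.hab'.symm F.hbb'.symm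
  rw [← sub_pos (a := y c), ← side_of_left F hp hy, mul_pos_iff_of_pos_right hpb]

omit hp in
theorem side_pos_iff_of_right {y : Tet} (hy : IsEdgePoint a b' y) :
    0 < side b b' c p q y ↔ q c < y c := by
  have hqb := hq.pos F.hab.symm F.hbb'
  rw [← sub_pos (a := y c), ← side_of_right F hq hy, mul_pos_iff_of_pos_right hqb]

omit hq in
theorem side_neg_iff_of_left {y : Tet} (hy : IsEdgePoint a b y) :
    side b b' c p q y < 0 ↔ y c < p c := by
  have hpb := hp.pos F.hab'.symm F.hbb'.symm
  rw [← sub_neg (a := y c), ← side_of_left F hp hy]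
  exact ⟨fun h ↦ mul_neg_of_neg_of_pos h hpb, fun h ↦ neg_of_mul_neg_left h hpb.le⟩

omit hp in
theorem side_neg_iff_of_right {y : Tet} (hy : IsEdgePoint a b' y) :
    side b b' c p q y < 0 ↔ y c < q c := by
  have hqb := hq.pos F.hab.symm F.hbb'
  rw [← sub_neg (a := y c), ← side_of_right F hq hy]
  exact ⟨fun h ↦ mul_neg_of_neg_of_pos h hqb, fun h ↦ neg_of_mul_neg_left h hqb.le⟩

end Frame

/-- If `x` and `y` lie on the same edge, then `X` and `Y` are in the same strict order as `x` and
`y`. -/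
def OrderTransfers (x X y Y : Tet) : Prop :=
  (∀ k, x k = 0 ↔ y k = 0) → ∀ k, (x k < y k → X k < Y k) ∧ (y k < x k → Y k < X k)

theorem IsEdgePoint.same_zeros {a b : Fin 4} {x y : Tet} (hx : IsEdgePoint a b x)
    (hy : IsEdgePoint a b y) (k : Fin 4) : x k = 0 ↔ y k = 0 := (hx k).trans (hy k).symm

/-- The sign of `side` at an edge point is given by comparison with the endpoint of the arc on the
same edge, or is negative on the third edge. -/
theorem side_transfers {a b b' c e : Fin 4} (F : FaceFrame a b b' c) {p q y P Q Y : Tet}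
    (hp : IsEdgePoint a b p) (hq : IsEdgePoint a b' q) (hy : IsEdgePoint a e y) (hea : e ≠ a)
    (hP : IsEdgePoint a b P) (hQ : IsEdgePoint a b' Q) (hY : IsEdgePoint a e Y)
    (h1 : OrderTransfers p P y Y) (h2 : OrderTransfers q Q y Y) :
    (0 < side b b' c p q y → 0 < side b b' c P Q Y) ∧
      (side b b' c p q y < 0 → side b b' c P Q Y < 0) := by
  rcases F.cases e with rfl | rfl | rfl | rfl
  · exact absurd rfl hea
  · rw [side_pos_iff_of_left F hp hy, side_pos_iff_of_left F hP hY,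
      side_neg_iff_of_left F hp hy, side_neg_iff_of_left F hP hY]
    exact h1 (hp.same_zeros hy) c
  · rw [side_pos_iff_of_right F hq hy, side_pos_iff_of_right F hQ hY,
      side_neg_iff_of_right F hq hy, side_neg_iff_of_right F hQ hY]
    exact h2 (hq.same_zeros hy) c
  · exact ⟨fun h ↦ absurd h (not_lt.mpr (side_of_opposite F hp hq hy).le),
      fun _ ↦ side_of_opposite F hP hQ hY⟩

/-- Disjointness of normal arcs depends only on the order of their endpoints on the edges. -/
theorem disjoint_seg_transfers {a b b' e e' : Fin 4} (hba : b ≠ a) (hb'a : b' ≠ a) (hbb' : b ≠ b')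
    (hea : e ≠ a) (he'a : e' ≠ a) {p q y z P Q Y Z : Tet}
    (hp : IsEdgePoint a b p) (hq : IsEdgePoint a b' q) (hy : IsEdgePoint a e y)
    (hz : IsEdgePoint a e' z)
    (hP : IsEdgePoint a b P) (hQ : IsEdgePoint a b' Q) (hY : IsEdgePoint a e Y)
    (hZ : IsEdgePoint a e' Z)
    (h1 : OrderTransfers p P y Y) (h2 : OrderTransfers q Q y Y)
    (h3 : OrderTransfers p P z Z) (h4 : OrderTransfers q Q z Z) (h : Disjoint (seg p q) (seg y z)) :
    Disjoint (seg P Q) (seg Y Z) := by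
  obtain ⟨c, F⟩ := exists_faceFrame hba hb'a hbb'
  rw [disjoint_seg_iff_side F hp hq hy.zero_left hz.zero_left] at h
  rw [disjoint_seg_iff_side F hP hQ hY.zero_left hZ.zero_left]
  have h5 := side_transfers F hp hq hy hea hP hQ hY h1 h2
  have h6 := side_transfers F hp hq hz he'a hP hQ hZ h3 h4
  rcases pos_and_pos_or_neg_and_neg_of_mul_pos h with ⟨h7, h8⟩ | ⟨h7, h8⟩
  · exact mul_pos (h5.1 h7) (h6.1 h8)
  · exact mul_pos_of_neg_of_neg (h5.2 h7) (h6.2 h8)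

end Segments

/-! ### Patterns: straight normal curves described by their endpoints. -/

section Patterns

/-- A system of disjoint straight normal arcs in the faces: `R a p q` says that `p` and `q` are
joined by an arc in the face `a`. -/
structure IsPattern (R : Fin 4 → Tet → Tet → Prop) : Prop where
  finite : {p | ∃ a q, R a p q}.Finite
  edge : ∀ {a p q}, R a p q →
    ∃ b b', b ≠ a ∧ b' ≠ a ∧ b ≠ b' ∧ IsEdgePoint a b p ∧ IsEdgePoint a b' q
  symm : ∀ {a p q}, R a p q → R a q p
  exists_joined : ∀ {a p q a'}, R a p q → p a' = 0 → ∃ q', R a' p q'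
  disjoint : ∀ {a p q p' q'}, R a p q → R a p' q' →
    (p' = p ∧ q' = q) ∨ (p' = q ∧ q' = p) ∨ Disjoint (seg p q) (seg p' q')

/-- The endpoints of the arcs of a pattern. -/
def points (R : Fin 4 → Tet → Tet → Prop) : Set Tet := {p | ∃ a q, R a p q}

/-- The union of the arcs of a pattern. -/
def curve (R : Fin 4 → Tet → Tet → Prop) : Set Tet := {x | ∃ a p q, R a p q ∧ x ∈ seg p q}

namespace IsPattern

variable {R : Fin 4 → Tet → Tet → Prop} (hR : IsPattern R)

include hR

theorem eq_endpoint {a k : Fin 4} {p q x : Tet} (h : R a p q) (hx : x ∈ seg p q) (hk : k ≠ a)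
    (hxk : x k = 0) : x = p ∨ x = q := by
  obtain ⟨b, b', hb, hb', hbb', hp, hq⟩ := hR.edge h
  exact eq_endpoint_of_mem_seg hbb' hp hq hx hk hxk

theorem zero {a : Fin 4} {p q x : Tet} (h : R a p q) (hx : x ∈ seg p q) : x a = 0 := by
  obtain ⟨b, b', hb, hb', hbb', hp, hq⟩ := hR.edge h
  exact segment_apply_zero hx hp.zero_left hq.zero_left

theorem zero_left {a : Fin 4} {p q : Tet} (h : R a p q) : p a = 0 := hR.zero h (left_mem_seg p q)

theorem ne {a : Fin 4} {p q : Tet} (h : R a p q) : p ≠ q := by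
  rintro rfl
  obtain ⟨b, b', hb, hb', hbb', hp, hq⟩ := hR.edge h
  exact ((hq b).mp hp.zero_right).elim hb hbb'

theorem unique {a : Fin 4} {p q q' : Tet} (h : R a p q) (h' : R a p q') : q' = q := by
  rcases hR.disjoint h h' with h1 | h1 | h1
  · exact h1.2
  · exact absurd h1.1 (hR.ne h)
  · exact absurd (left_mem_seg p q') (Set.disjoint_left.mp h1 (left_mem_seg p q))

theorem exists_isEdgePoint {p : Tet} (hp : p ∈ points R) {a b : Fin 4} (hab : a ≠ b) (ha : p a = 0)
    (hb : p b = 0) : IsEdgePoint a b p := by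
  obtain ⟨a', q, h⟩ := hp
  obtain ⟨q', h'⟩ := hR.exists_joined h ha
  obtain ⟨c, c', hc, hc', hcc', hp, hq⟩ := hR.edge h'
  have := (hp b).mp hb
  obtain rfl : b = c := by grind
  exact hp

theorem mem_points_of_mem_curve {x : Tet} (hx : x ∈ curve R) {a b : Fin 4} (hab : a ≠ b)
    (ha : x a = 0) (hb : x b = 0) : x ∈ points R := by
  obtain ⟨c, p, q, h, hxs⟩ := hx
  have : ∃ k, k ≠ c ∧ x k = 0 := by
    by_cases hc : a = c
    · exact ⟨b, hc ▸ hab.symm, hb⟩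
    · exact ⟨a, hc, ha⟩
  obtain ⟨k, hk, hxk⟩ := this
  rcases hR.eq_endpoint h hxs hk hxk with rfl | rfl
  · exact ⟨c, q, h⟩
  · exact ⟨c, p, hR.symm h⟩

omit hR in
theorem points_subset_curve : points R ⊆ curve R := fun p ⟨a, q, h⟩ ↦ ⟨a, p, q, h, left_mem_seg p q⟩

theorem exists_seg_of_mem_face {x : Tet} (hx : x ∈ curve R) {a : Fin 4} (ha : x a = 0) :
    ∃ p q, R a p q ∧ x ∈ seg p q := by
  obtain ⟨c, p, q, h, hxs⟩ := hx
  by_cases hc : a = c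
  · subst hc
    exact ⟨p, q, h, hxs⟩
  · have hxp := hR.mem_points_of_mem_curve ⟨c, p, q, h, hxs⟩ hc ha (hR.zero h hxs)
    obtain ⟨e, y, hy⟩ := hxp
    obtain ⟨z, hz⟩ := hR.exists_joined hy ha
    exact ⟨x, z, hz, left_mem_seg x z⟩

theorem setOf_curve_eq {a b : Fin 4} (hab : a ≠ b) :
    {x ∈ curve R | x a = 0 ∧ x b = 0} = {x ∈ points R | x a = 0 ∧ x b = 0} := by
  ext x
  exact ⟨fun h ↦ ⟨hR.mem_points_of_mem_curve h.1 hab h.2.1 h.2.2, h.2⟩,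
    fun h ↦ ⟨points_subset_curve h.1, h.2⟩⟩

theorem finite_arcs (a : Fin 4) : {A | ∃ p q, R a p q ∧ A = seg p q}.Finite := by
  refine ((hR.finite.prod hR.finite).image fun p ↦ seg p.1 p.2).subset ?_
  rintro _ ⟨p, q, h, rfl⟩
  exact ⟨(p, q), ⟨⟨a, q, h⟩, ⟨a, p, hR.symm h⟩⟩, rfl⟩

theorem pairwiseDisjoint_arcs (a : Fin 4) :
    {A | ∃ p q, R a p q ∧ A = seg p q}.PairwiseDisjoint id := by
  rintro _ ⟨p, q, h, rfl⟩ _ ⟨p', q', h', rfl⟩ hne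
  rcases hR.disjoint h h' with ⟨rfl, rfl⟩ | ⟨rfl, rfl⟩ | hd
  · exact absurd rfl hne
  · exact absurd (seg_comm _ _) hne
  · exact hd

theorem curve_inter_face (a : Fin 4) :
    curve R ∩ face a = ⋃₀ {A | ∃ p q, R a p q ∧ A = seg p q} := by
  ext x
  constructor
  · rintro ⟨hx, hxa⟩
    obtain ⟨p, q, h, hxs⟩ := hR.exists_seg_of_mem_face hx hxa
    exact ⟨_, ⟨p, q, h, rfl⟩, hxs⟩
  · rintro ⟨_, ⟨p, q, h, rfl⟩, hx⟩
    exact ⟨⟨a, p, q, h, hx⟩, hR.zero h hx⟩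

theorem curve_subset_tetBoundary : curve R ⊆ tetBoundary :=
  fun _ ⟨a, _, _, h, hx⟩ ↦ ⟨a, hR.zero h hx⟩

theorem isStraightNormalCurve : IsStraightNormalCurve (curve R) := by
  refine ⟨hR.curve_subset_tetBoundary, fun a ↦ ⟨_, hR.finite_arcs a, ?_,
    hR.pairwiseDisjoint_arcs a, hR.curve_inter_face a⟩⟩
  rintro _ ⟨p, q, h, rfl⟩
  obtain ⟨b, b', hb, hb', hbb', hp, hq⟩ := hR.edge h
  exact ⟨b, b', hb, hb', hbb', p, q, hp, hq, rfl⟩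

theorem isArcwise : IsArcwise (curve R) := by
  refine ⟨hR.curve_subset_tetBoundary, fun a ↦ ⟨_, hR.finite_arcs a, hR.pairwiseDisjoint_arcs a,
    hR.curve_inter_face a, ?_⟩⟩
  rintro _ ⟨p, q, h, rfl⟩
  refine ⟨(isCompact_seg p q).isClosed, isPreconnected_seg p q, ?_⟩
  rintro k hk x ⟨hx, hxk⟩ y ⟨hy, hyk⟩
  obtain ⟨b, b', hb, hb', hbb', hp, hq⟩ := hR.edge h
  have h1 := (hp k).mp
  have h2 := (hq k).mp
  rcases hR.eq_endpoint h hx hk hxk with rfl | rfl <;>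
    rcases hR.eq_endpoint h hy hk hyk with rfl | rfl
  · rfl
  · grind
  · grind
  · rfl

end IsPattern

theorem IsStraightNormalCurve.exists_pattern {K : Set Tet} (hK : IsStraightNormalCurve K) :
    ∃ R, IsPattern R ∧ curve R = K := by
  obtain ⟨hKb, hK⟩ := hK
  choose 𝒜 hfin harc hd hcov using hK
  let R : Fin 4 → Tet → Tet → Prop := fun a p q ↦ seg p q ∈ 𝒜 a ∧
    ∃ b b', b ≠ a ∧ b' ≠ a ∧ b ≠ b' ∧ IsEdgePoint a b p ∧ IsEdgePoint a b' q
  have hend : ∀ {a p q x}, R a p q → x ∈ seg p q → ∀ k, k ≠ a → x k = 0 → x = p ∨ x = q := by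
    rintro a p q x ⟨-, b, b', hb, hb', hbb', hp, hq⟩ hx k hk hxk
    exact eq_endpoint_of_mem_seg hbb' hp hq hx hk hxk
  -- An arc determines its two endpoints up to order: they are its only points with a vanishing
  -- coordinate besides `a`.
  have hends : ∀ {a p q p' q'}, R a p q → R a p' q' → seg p q = seg p' q' →
      (p' = p ∧ q' = q) ∨ (p' = q ∧ q' = p) := by
    intro a p q p' q' h h' he
    obtain ⟨-, b, b', hb, hb', hbb', hp, hq⟩ := id h'
    have h1 := hend h (he ▸ left_mem_seg p' q') b hb hp.zero_right
    have h2 := hend h (he ▸ right_mem_seg p' q') b' hb' hq.zero_right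
    have hne : p' ≠ q' := by
      rintro rfl
      exact ((hq b).mp hp.zero_right).elim hb hbb'
    grind
  have hsymm : ∀ {a p q}, R a p q → R a q p := by
    rintro a p q ⟨h, b, b', hb, hb', hbb', hp, hq⟩
    exact ⟨seg_comm p q ▸ h, b', b, hb', hb, hbb'.symm, hq, hp⟩
  have hseg : ∀ a x, x ∈ K → x a = 0 → ∃ p q, R a p q ∧ x ∈ seg p q := by
    intro a x hx hxa
    have hxF : x ∈ K ∩ face a := ⟨hx, hxa⟩
    rw [hcov] at hxF
    obtain ⟨A, hA, hxA⟩ := hxF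
    obtain ⟨b, b', hb, hb', hbb', p, q, hp, hq, rfl⟩ := harc a A hA
    exact ⟨p, q, ⟨hA, b, b', hb, hb', hbb', hp, hq⟩, hxA⟩
  have hsub : ∀ {a p q}, R a p q → seg p q ⊆ K := fun {a p q} h x hx ↦
    (hcov a ▸ Set.mem_sUnion_of_mem hx h.1 : x ∈ K ∩ face a).1
  refine ⟨R, ⟨?_, fun h ↦ h.2, hsymm, ?_, ?_⟩, ?_⟩
  · refine (Set.finite_iUnion fun a ↦ (hfin a).biUnion (t := fun A ↦
      {p | ∃ q, R a p q ∧ seg p q = A}) fun A _ ↦ ?_).subset ?_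
    · by_cases hne : {p | ∃ q, R a p q ∧ seg p q = A}.Nonempty
      · obtain ⟨p, q, h, rfl⟩ := hne
        refine (Set.toFinite {p, q}).subset ?_
        rintro p' ⟨q', h', he⟩
        rcases hends h h' he.symm with h1 | h1
        · exact Or.inl h1.1
        · exact Or.inr h1.1
      · rw [Set.not_nonempty_iff_eq_empty.mp hne]
        exact Set.finite_empty
    · rintro p ⟨a, q, h⟩
      exact Set.mem_iUnion_of_mem a (Set.mem_biUnion h.1 ⟨q, h, rfl⟩)
  -- The curve continues across an edge: `p` lies on an arc of `K` in the face `a'`, and it must be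
  -- an endpoint of it because its coordinate `a` vanishes too.
  · intro a p q a' h hpa'
    by_cases haa' : a' = a
    · exact ⟨q, haa' ▸ h⟩
    · obtain ⟨p', q', h', hx⟩ := hseg a' p (hsub h (left_mem_seg p q)) hpa'
      obtain ⟨-, b, b', hb, hb', hbb', hp, hq⟩ := h
      rcases hend h' hx a (Ne.symm haa') hp.zero_left with rfl | rfl
      · exact ⟨q', h'⟩
      · exact ⟨p', hsymm h'⟩
  · intro a p q p' q' h h'
    by_cases he : seg p q = seg p' q'
    · rcases hends h h' he with h1 | h1
      · exact Or.inl h1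
      · exact Or.inr (Or.inl h1)
    · exact Or.inr (Or.inr (hd a h.1 h'.1 he))
  · ext x
    constructor
    · rintro ⟨a, p, q, h, hx⟩
      exact hsub h hx
    · intro hx
      obtain ⟨a, ha⟩ := hKb hx
      obtain ⟨p, q, h, hxs⟩ := hseg a x hx ha
      exact ⟨a, p, q, h, hxs⟩

end Patterns

/-! ### Moving the endpoints of a pattern extends to an isotopy. -/

section PatternIsotopy

theorem segPoint_zero_iff (p q : Tet) (s : unitInterval) (k : Fin 4) :
    segPoint p q s k = 0 ↔ (s.1 = 1 ∨ p k = 0) ∧ (s.1 = 0 ∨ q k = 0) := by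
  rw [segPoint_apply]
  have h1 := mul_nonneg (sub_nonneg.mpr s.2.2) (tet_nonneg p k)
  have h2 := mul_nonneg s.2.1 (tet_nonneg q k)
  rw [add_eq_zero_iff_of_nonneg h1 h2, mul_eq_zero, mul_eq_zero, sub_eq_zero, eq_comm (a := (1 : ℝ))]

theorem segPoint_same_zeros {p P q Q : Tet} (hp : ∀ k, P k = 0 ↔ p k = 0)
    (hq : ∀ k, Q k = 0 ↔ q k = 0) (s : unitInterval) (k : Fin 4) :
    segPoint P Q s k = 0 ↔ segPoint p q s k = 0 := by
  rw [segPoint_zero_iff, segPoint_zero_iff, hp, hq]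

theorem segPoint_self_zero_iff {p P : Tet} (hp : ∀ k, P k = 0 ↔ p k = 0) (s : unitInterval)
    (k : Fin 4) : segPoint p P s k = 0 ↔ p k = 0 := by
  rw [segPoint_zero_iff, hp]
  constructor
  · rintro ⟨h1 | h1, h2 | h2⟩
    · exact absurd (h1.symm.trans h2) one_ne_zero
    all_goals assumption
  · exact fun h ↦ ⟨Or.inr h, Or.inr h⟩

/-- Both sides are the bilinear interpolation of four points. Hence linear motion of the points of
an arc agrees at each time with the straight arc between the moved endpoints. -/
theorem segPoint_interchange (p q P Q : Tet) (s t : unitInterval) :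
    segPoint (segPoint p q s) (segPoint P Q s) t = segPoint (segPoint p P t) (segPoint q Q t) s := by
  refine tet_ext fun k ↦ ?_
  simp only [segPoint_apply]
  ring

theorem segPoint_zero (p q : Tet) : segPoint p q 0 = p := by
  refine tet_ext fun k ↦ ?_
  simp [segPoint_apply]

theorem segPoint_one (p q : Tet) : segPoint p q 1 = q := by
  refine tet_ext fun k ↦ ?_
  simp [segPoint_apply]

theorem segPoint_mem_seg (p q : Tet) (s : unitInterval) : segPoint p q s ∈ seg p q :=
  seg_eq_range p q ▸ Set.mem_range_self s

theorem segPoint_symm (p q : Tet) (s : unitInterval) :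
    segPoint q p (unitInterval.symm s) = segPoint p q s := by
  refine tet_ext fun k ↦ ?_
  simp only [segPoint_apply, unitInterval.coe_symm_eq]
  ring

theorem segPoint_injective {p q : Tet} (h : p ≠ q) : Function.Injective (segPoint p q) := by
  intro s t hst
  have : ∃ k, p k ≠ q k := by
    by_contra! hc
    exact h (tet_ext hc)
  obtain ⟨k, hk⟩ := this
  have h1 : segPoint p q s k = segPoint p q t k := by rw [hst]
  rw [segPoint_apply, segPoint_apply] at h1
  have h2 : (s.1 - t.1) * (q k - p k) = 0 := by linear_combination h1
  rcases mul_eq_zero.mp h2 with h3 | h3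
  · exact Subtype.ext (sub_eq_zero.mp h3)
  · exact absurd (sub_eq_zero.mp h3).symm hk

theorem IsEdgePoint.congr {a b : Fin 4} {p P : Tet} (hp : IsEdgePoint a b p)
    (h : ∀ k, P k = 0 ↔ p k = 0) : IsEdgePoint a b P := fun k ↦ (h k).trans (hp k)

/-- `g` moves the points of a pattern along the edges and preserves their order. -/
structure MovesAlongEdges (R : Fin 4 → Tet → Tet → Prop) (g : Tet → Tet) : Prop where
  zeros : ∀ p ∈ points R, ∀ k, g p k = 0 ↔ p k = 0
  lt : ∀ p ∈ points R, ∀ q ∈ points R, (∀ k, p k = 0 ↔ q k = 0) → ∀ k, p k < q k → g p k < g q k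

namespace MovesAlongEdges

variable {R : Fin 4 → Tet → Tet → Prop} {g : Tet → Tet}

theorem orderTransfers (hg : MovesAlongEdges R g) {p q : Tet} (hp : p ∈ points R)
    (hq : q ∈ points R) : OrderTransfers p (g p) q (g q) :=
  fun h k ↦ ⟨hg.lt p hp q hq h k, hg.lt q hq p hp (fun j ↦ (h j).symm) k⟩

theorem injOn (hg : MovesAlongEdges R g) : Set.InjOn g (points R) := by
  intro p hp q hq h
  have hz : ∀ k, p k = 0 ↔ q k = 0 := fun k ↦ by rw [← hg.zeros p hp, h, hg.zeros q hq]
  refine tet_ext fun k ↦ ?_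
  by_contra hne
  rcases lt_or_gt_of_ne hne with h1 | h1
  · exact absurd (hg.lt p hp q hq hz k h1) (by rw [h]; exact lt_irrefl _)
  · exact absurd (hg.lt q hq p hp (fun j ↦ (hz j).symm) k h1) (by rw [h]; exact lt_irrefl _)

theorem id (R : Fin 4 → Tet → Tet → Prop) : MovesAlongEdges R id :=
  ⟨fun _ _ _ ↦ Iff.rfl, fun _ _ _ _ _ _ h ↦ h⟩

/-- The zero set and the order of points on an edge are both preserved under convex combination with
the identity. -/
theorem interpolate (hg : MovesAlongEdges R g) (t : unitInterval) :
    MovesAlongEdges R fun p ↦ segPoint p (g p) t where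
  zeros p hp := segPoint_self_zero_iff (hg.zeros p hp) t
  lt p hp q hq h k hlt := by
    simp only [segPoint_apply]
    have h1 := hg.lt p hp q hq h k hlt
    rcases eq_or_lt_of_le t.2.1 with h0 | h0
    · rw [← h0]
      linarith
    · have := mul_lt_mul_of_pos_left h1 h0
      have := mul_le_mul_of_nonneg_left hlt.le (sub_nonneg.mpr t.2.2)
      linarith

theorem ne (hg : MovesAlongEdges R g) (hR : IsPattern R) {a : Fin 4} {p q : Tet} (h : R a p q) :
    g p ≠ g q := fun he ↦ hR.ne h (hg.injOn ⟨a, q, h⟩ ⟨a, p, hR.symm h⟩ he)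

/-- A point of a moved arc on a second face is an endpoint, so its parameter is `0` or `1`; such a
point follows the same vertex of the pattern under every `f`. -/
theorem exists_endpoint (hg : MovesAlongEdges R g) (hR : IsPattern R) {a k : Fin 4} {p q : Tet}
    (h : R a p q) {s : unitInterval} (hk : k ≠ a) (hz : segPoint (g p) (g q) s k = 0) :
    ∃ r ∈ points R, segPoint (g p) (g q) s = g r ∧
      ∀ f : Tet → Tet, segPoint (f p) (f q) s = f r := by
  have hp : p ∈ points R := ⟨a, q, h⟩
  have hq : q ∈ points R := ⟨a, p, hR.symm h⟩
  obtain ⟨b, b', hb, hb', hbb', hpe, hqe⟩ := hR.edge h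
  rcases eq_endpoint_of_mem_seg hbb' (hpe.congr (hg.zeros p hp)) (hqe.congr (hg.zeros q hq))
    (segPoint_mem_seg (g p) (g q) s) hk hz with h1 | h1
  · have : s = 0 := segPoint_injective (hg.ne hR h) (h1.trans (segPoint_zero _ _).symm)
    subst this
    exact ⟨p, hp, h1, fun f ↦ segPoint_zero _ _⟩
  · have : s = 1 := segPoint_injective (hg.ne hR h) (h1.trans (segPoint_one _ _).symm)
    subst this
    exact ⟨q, hq, h1, fun f ↦ segPoint_one _ _⟩

/-- The coincidences between points of the arcs are the same for all positions of the
endpoints. -/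
theorem segPoint_eq_of_eq (hg : MovesAlongEdges R g) (hR : IsPattern R) {a a' : Fin 4}
    {p q p' q' : Tet} (h : R a p q) (h' : R a' p' q') {s s' : unitInterval}
    (he : segPoint (g p) (g q) s = segPoint (g p') (g q') s') (f : Tet → Tet) :
    segPoint (f p) (f q) s = segPoint (f p') (f q') s' := by
  have hp : p ∈ points R := ⟨a, q, h⟩
  have hq : q ∈ points R := ⟨a, p, hR.symm h⟩
  have hp' : p' ∈ points R := ⟨a', q', h'⟩
  have hq' : q' ∈ points R := ⟨a', p', hR.symm h'⟩
  obtain ⟨b, b', hb, hb', hbb', hpe, hqe⟩ := hR.edge h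
  obtain ⟨e, e', hea, he'a, hee', hpe', hqe'⟩ := hR.edge h'
  by_cases haa' : a = a'
  · subst haa'
    rcases hR.disjoint h h' with ⟨rfl, rfl⟩ | ⟨rfl, rfl⟩ | hd
    · rw [segPoint_injective (hg.ne hR h) he]
    · rw [← segPoint_symm (g q') (g p')] at he
      rw [← segPoint_injective (hg.ne hR h') he, segPoint_symm]
    -- Distinct arcs in one face stay disjoint since the order of their endpoints is kept, so they
    -- have no coincidence.
    · have hd' := disjoint_seg_transfers hb hb' hbb' hea he'a hpe hqe hpe' hqe'
        (hpe.congr (hg.zeros p hp)) (hqe.congr (hg.zeros q hq)) (hpe'.congr (hg.zeros p' hp'))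
        (hqe'.congr (hg.zeros q' hq')) (hg.orderTransfers hp hp') (hg.orderTransfers hq hp')
        (hg.orderTransfers hp hq') (hg.orderTransfers hq hq') hd
      exact absurd (he ▸ segPoint_mem_seg _ _ s') (Set.disjoint_left.mp hd' (segPoint_mem_seg _ _ s))
  -- A point common to arcs in different faces lies on an edge, so it is an endpoint of both; `g` is
  -- injective on endpoints.
  · have hz : segPoint (g p) (g q) s a' = 0 := by
      rw [he]
      exact segment_apply_zero (segPoint_mem_seg _ _ _)
        ((hg.zeros p' hp' a').mpr hpe'.zero_left) ((hg.zeros q' hq' a').mpr hqe'.zero_left)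
    have hz' : segPoint (g p') (g q') s' a = 0 := by
      rw [← he]
      exact segment_apply_zero (segPoint_mem_seg _ _ _)
        ((hg.zeros p hp a).mpr hpe.zero_left) ((hg.zeros q hq a).mpr hqe.zero_left)
    obtain ⟨r, hr, h1, h2⟩ := hg.exists_endpoint hR h (Ne.symm haa') hz
    obtain ⟨r', hr', h1', h2'⟩ := hg.exists_endpoint hR h' haa' hz'
    rw [h2, h2', hg.injOn hr hr' (by rw [← h1, ← h1', he])]

end MovesAlongEdges

theorem continuous_segPoint_uncurry :
    Continuous fun x : Tet × Tet × unitInterval ↦ segPoint x.1 x.2.1 x.2.2 := by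
  unfold segPoint
  fun_prop

/-- A motion of the points of a pattern along the edges extends to an isotopy of the arcs. -/
theorem MovesAlongEdges.normallyIsotopic {R R' : Fin 4 → Tet → Tet → Prop} (hR : IsPattern R)
    (hR' : IsPattern R') {f : Tet → Tet} (hf : MovesAlongEdges R f)
    (hjoin : ∀ a p q, R a p q → R' a (f p) (f q))
    (hsurj : ∀ p' ∈ points R', ∃ p ∈ points R, f p = p') :
    NormallyIsotopic (curve R) (curve R') := by
  classical
  have hmem : ∀ x ∈ curve R, ∃ a p q s, R a p q ∧ x = segPoint p q s := by
    rintro x ⟨a, p, q, h, hx⟩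
    rw [seg_eq_range] at hx
    obtain ⟨s, rfl⟩ := hx
    exact ⟨a, p, q, s, h, rfl⟩
  -- The map `G` extends `f` affinely over each arc. It is well defined because coincidences between
  -- arc points persist when the endpoints are moved from their original position by `f`.
  have hG : ∃ G : Tet → Tet, ∀ a p q s, R a p q → G (segPoint p q s) = segPoint (f p) (f q) s := by
    refine ⟨fun x ↦ if h : ∃ y, ∃ a p q s, R a p q ∧ x = segPoint p q s ∧
      y = segPoint (f p) (f q) s then h.choose else x, fun a p q s h ↦ ?_⟩
    have hex : ∃ y, ∃ a' p' q' s', R a' p' q' ∧ segPoint p q s = segPoint p' q' s' ∧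
      y = segPoint (f p') (f q') s' := ⟨_, a, p, q, s, h, rfl, rfl⟩
    simp only [dif_pos hex]
    obtain ⟨a', p', q', s', h', h1, h2⟩ := hex.choose_spec
    rw [h2]
    exact (MovesAlongEdges.id R).segPoint_eq_of_eq hR h' h h1.symm f
  obtain ⟨G, hG⟩ := hG
  have hcont : ContinuousOn G (curve R) := by
    have hfin : Finite {x : Tet × Tet // ∃ a, R a x.1 x.2} := by
      refine ((hR.finite.prod hR.finite).subset ?_ : {x : Tet × Tet | ∃ a, R a x.1 x.2}.Finite)
      rintro x ⟨a, h⟩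
      exact ⟨⟨a, _, h⟩, ⟨a, _, hR.symm h⟩⟩
    have hU : curve R = ⋃ x : {x : Tet × Tet // ∃ a, R a x.1 x.2}, seg x.1.1 x.1.2 := by
      ext x
      simp only [Set.mem_iUnion]
      constructor
      · rintro ⟨a, p, q, h, hx⟩
        exact ⟨⟨(p, q), a, h⟩, hx⟩
      · rintro ⟨⟨⟨p, q⟩, a, h⟩, hx⟩
        exact ⟨a, p, q, h, hx⟩
    rw [hU]
    refine LocallyFinite.continuousOn_iUnion (locallyFinite_of_finite _)
      (fun x ↦ (isCompact_seg _ _).isClosed) ?_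
    rintro ⟨⟨p, q⟩, a, h⟩
    -- On one arc the parameter is an affine function of a coordinate that separates the endpoints,
    -- which gives continuity there; the finite closed cover by arcs does the rest.
    obtain ⟨k, hk⟩ : ∃ k, q k - p k ≠ 0 := by
      by_contra! hc
      exact hR.ne h (tet_ext fun k ↦ (sub_eq_zero.mp (hc k)).symm)
    rw [Topology.IsInducing.subtypeVal.continuousOn_iff]
    have h0 : Continuous fun x : Tet ↦ (x.1 k - p k) / (q k - p k) :=
      (((continuous_apply k).comp continuous_subtype_val).sub continuous_const).div_const _
    have h1 : ContinuousOn (fun x : Tet ↦ (1 - (x.1 k - p k) / (q k - p k)) • (f p).1 +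
        ((x.1 k - p k) / (q k - p k)) • (f q).1) (seg p q) :=
      (((continuous_const.sub h0).smul continuous_const).add
        (h0.smul continuous_const)).continuousOn
    refine h1.congr ?_
    intro x hx
    rw [seg_eq_range] at hx
    obtain ⟨s, rfl⟩ := hx
    have h2 : ((segPoint p q s).1 k - p k) / (q k - p k) = s := by
      change (segPoint p q s k - p k) / (q k - p k) = s
      rw [segPoint_apply, div_eq_iff hk]
      ring
    simp only [Function.comp, hG a p q s h, h2]
    rfl
  have hcont' : Continuous fun x : curve R ↦ G x := continuousOn_iff_continuous_domRestrict.mp hcont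
  have hzero : ∀ x ∈ curve R, ∀ k, G x k = 0 ↔ x k = 0 := by
    intro x hx k
    obtain ⟨a, p, q, s, h, rfl⟩ := hmem x hx
    rw [hG a p q s h]
    exact segPoint_same_zeros (hf.zeros p ⟨a, q, h⟩) (hf.zeros q ⟨a, p, hR.symm h⟩) s k
  -- The isotopy moves each point linearly to its image under `G`.
  refine ⟨⟨fun x ↦ segPoint x.2.1 (G x.2.1) x.1, ?_⟩, ?_, ?_, ?_, ?_⟩
  · exact continuous_segPoint_uncurry.comp
      ((continuous_subtype_val.comp continuous_snd).prodMk
        ((hcont'.comp continuous_snd).prodMk continuous_fst))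
  · rintro t ⟨x, hx⟩ ⟨y, hy⟩ hxy
    obtain ⟨a, p, q, s, h, rfl⟩ := hmem x hx
    obtain ⟨a', p', q', s', h', rfl⟩ := hmem y hy
    have hxy' : segPoint (segPoint p q s) (G (segPoint p q s)) t =
        segPoint (segPoint p' q' s') (G (segPoint p' q' s')) t := hxy
    -- At time `t` the isotopy is the arc map of the interpolated motion, so a coincidence at time
    -- `t` already holds in the original pattern.
    rw [hG a p q s h, hG a' p' q' s' h', segPoint_interchange p, segPoint_interchange p'] at hxy'
    exact Subtype.ext ((hf.interpolate t).segPoint_eq_of_eq hR h h' hxy' fun x ↦ x)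
  · exact fun x ↦ segPoint_zero _ _
  · ext y
    simp only [ContinuousMap.coe_mk, segPoint_one, Set.mem_range]
    constructor
    · rintro ⟨⟨x, hx⟩, rfl⟩
      obtain ⟨a, p, q, s, h, rfl⟩ := hmem x hx
      rw [hG a p q s h]
      exact ⟨a, f p, f q, hjoin a p q h, segPoint_mem_seg _ _ _⟩
    · rintro ⟨a, p', q', h', hy⟩
      rw [seg_eq_range] at hy
      obtain ⟨s, rfl⟩ := hy
      obtain ⟨p, hp, rfl⟩ := hsurj p' ⟨a, q', h'⟩
      have hpa : p a = 0 := (hf.zeros p hp a).mp (hR'.zero_left h')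
      obtain ⟨e, r, hr⟩ := hp
      obtain ⟨q, h⟩ := hR.exists_joined hr hpa
      obtain rfl := hR'.unique (hjoin a p q h) h'
      exact ⟨⟨segPoint p q s, a, p, q, h, segPoint_mem_seg _ _ _⟩, hG a p q s h⟩
  · rintro t ⟨x, hx⟩ k
    exact segPoint_self_zero_iff (hzero x hx) t k

end PatternIsotopy

/-! ### Edge weights determine a pattern up to normal isotopy. -/

section Ranks

/-- The points of a pattern on the edge that the faces `a` and `b` share. -/
def edgePoints (R : Fin 4 → Tet → Tet → Prop) (a b : Fin 4) : Set Tet :=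
  {x ∈ points R | x a = 0 ∧ x b = 0}

/-- The number of points of a pattern between `p` and the end `c` of the edge that the faces `a` and
`b` share. -/
def rank (R : Fin 4 → Tet → Tet → Prop) (a b c : Fin 4) (p : Tet) : ℕ :=
  {x ∈ edgePoints R a b | p c < x c}.ncard

/-- The points on the edge of the faces `a` and `b` that are joined, in the face `a`, to points on
the edge of the faces `a` and `b'`. -/
def joinedPoints (R : Fin 4 → Tet → Tet → Prop) (a b b' : Fin 4) : Set Tet :=
  {x ∈ edgePoints R a b | ∃ y ∈ edgePoints R a b', R a x y}

theorem edgePoints_comm (R : Fin 4 → Tet → Tet → Prop) (a b : Fin 4) :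
    edgePoints R a b = edgePoints R b a := by
  ext x
  simp only [edgePoints, Set.mem_ofPred_eq, and_comm (a := x a = 0)]

theorem rank_comm (R : Fin 4 → Tet → Tet → Prop) (a b c : Fin 4) :
    rank R a b c = rank R b a c := by
  unfold rank
  rw [edgePoints_comm]

namespace IsPattern

variable {R : Fin 4 → Tet → Tet → Prop} (hR : IsPattern R)

include hR

theorem finite_edgePoints (a b : Fin 4) : (edgePoints R a b).Finite :=
  hR.finite.subset fun _ hx ↦ hx.1

theorem edgeWeight_curve {a b : Fin 4} (hab : a ≠ b) :
    edgeWeight (curve R) a b = (edgePoints R a b).ncard := by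
  rw [edgeWeight, hR.setOf_curve_eq hab, edgePoints]

theorem isEdgePoint {a b : Fin 4} (hab : a ≠ b) {p : Tet} (hp : p ∈ edgePoints R a b) :
    IsEdgePoint a b p := hR.exists_isEdgePoint hp.1 hab hp.2.1 hp.2.2

theorem exists_edgePoints {p : Tet} (hp : p ∈ points R) : ∃ a b, a ≠ b ∧ p ∈ edgePoints R a b := by
  obtain ⟨a, q, h⟩ := id hp
  obtain ⟨b, b', hb, -, -, hpe, -⟩ := hR.edge h
  exact ⟨a, b, hb.symm, hp, hpe.zero_left, hpe.zero_right⟩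

theorem mem_edgePoints {a : Fin 4} {p q : Tet} (h : R a p q) :
    ∃ b b', b ≠ a ∧ b' ≠ a ∧ b ≠ b' ∧ p ∈ edgePoints R a b ∧ q ∈ edgePoints R a b' := by
  obtain ⟨b, b', hb, hb', hbb', hp, hq⟩ := hR.edge h
  exact ⟨b, b', hb, hb', hbb', ⟨⟨a, q, h⟩, hp.zero_left, hp.zero_right⟩,
    ⟨⟨a, p, hR.symm h⟩, hq.zero_left, hq.zero_right⟩⟩

theorem edge_unique {a b b' : Fin 4} (hab : a ≠ b) {p : Tet} (hp : p ∈ edgePoints R a b)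
    (hab' : a ≠ b') (hp' : p ∈ edgePoints R a b') : b = b' := by
  have h1 := (hR.isEdgePoint hab hp b').mp hp'.2.2
  exact (h1.resolve_left hab'.symm).symm

theorem rank_lt_ncard {a b c : Fin 4} {p : Tet} (hp : p ∈ edgePoints R a b) :
    rank R a b c p < (edgePoints R a b).ncard := by
  refine Set.ncard_lt_ncard ⟨fun x hx ↦ hx.1, fun h ↦ ?_⟩ (hR.finite_edgePoints a b)
  exact lt_irrefl _ (h hp).2

theorem rank_lt_rank {a b c : Fin 4} {p q : Tet} (hq : q ∈ edgePoints R a b)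
    (h : p c < q c) : rank R a b c q < rank R a b c p := by
  refine Set.ncard_lt_ncard ⟨fun x hx ↦ ⟨hx.1, h.trans hx.2⟩, fun h' ↦ ?_⟩
    ((hR.finite_edgePoints a b).subset fun x hx ↦ hx.1)
  exact lt_irrefl _ (h' ⟨hq, h⟩).2

theorem lt_of_rank_lt {a b c : Fin 4} {p q : Tet} (hq : q ∈ edgePoints R a b)
    (h : rank R a b c p < rank R a b c q) : q c < p c := by
  by_contra! hle
  rcases eq_or_lt_of_le hle with h1 | h1
  · rw [rank, rank, h1] at h
    exact lt_irrefl _ h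
  · exact absurd (hR.rank_lt_rank hq h1) (not_lt.mpr h.le)

theorem eq_of_rank_eq {a b b' c : Fin 4} (F : FaceFrame a b b' c) {p q : Tet}
    (hp : p ∈ edgePoints R a b) (hq : q ∈ edgePoints R a b)
    (h : rank R a b c p = rank R a b c q) : p = q := by
  refine (hR.isEdgePoint F.hab hp).ext F (hR.isEdgePoint F.hab hq) ?_
  rcases lt_trichotomy (p c) (q c) with h1 | h1 | h1
  · exact absurd (hR.rank_lt_rank hq h1) (by omega)
  · exact h1
  · exact absurd (hR.rank_lt_rank hp h1) (by omega)

theorem exists_rank_eq {a b b' c : Fin 4} (F : FaceFrame a b b' c) {r : ℕ}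
    (hr : r < (edgePoints R a b).ncard) : ∃ p ∈ edgePoints R a b, rank R a b c p = r := by
  have hfin := hR.finite_edgePoints a b
  have := Finset.surjOn_of_injOn_of_card_le (s := hfin.toFinset)
    (t := Finset.range (edgePoints R a b).ncard) (rank R a b c)
    (fun p hp ↦ by simpa using hR.rank_lt_ncard (by simpa using hp))
    (fun p hp q hq h ↦ hR.eq_of_rank_eq F (by simpa using hp) (by simpa using hq) h)
    (by rw [Finset.card_range, Set.ncard_eq_toFinset_card _ hfin])
  obtain ⟨p, hp, h⟩ := this (by simpa using hr)
  exact ⟨p, by simpa using hp, h⟩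

/-- On an edge the coordinates `c` and `b'` add up to `1`, so they order the points oppositely. Thus
the ranks from the two ends determine each other. -/
theorem rank_add_rank {a b b' c : Fin 4} (F : FaceFrame a b b' c) {p : Tet}
    (hp : p ∈ edgePoints R a b) :
    rank R a b c p + rank R a b b' p + 1 = (edgePoints R a b).ncard := by
  have hfin := hR.finite_edgePoints a b
  have hlt : ∀ x ∈ edgePoints R a b, p b' < x b' ↔ x c < p c := by
    intro x hx
    have h1 := F.sum hx.2.1
    have h2 := F.sum hp.2.1
    rw [hx.2.2] at h1
    rw [hp.2.2] at h2
    constructor <;> intro <;> linarith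
  have hU : edgePoints R a b =
      insert p ({x ∈ edgePoints R a b | p c < x c} ∪ {x ∈ edgePoints R a b | p b' < x b'}) := by
    ext x
    simp only [Set.mem_insert_iff, Set.mem_union, Set.mem_ofPred_eq]
    constructor
    · intro hx
      rw [hlt x hx]
      rcases lt_trichotomy (p c) (x c) with h1 | h1 | h1
      · exact Or.inr (Or.inl ⟨hx, h1⟩)
      · exact Or.inl ((hR.isEdgePoint F.hab hx).ext F (hR.isEdgePoint F.hab hp) h1.symm)
      · exact Or.inr (Or.inr ⟨hx, h1⟩)
    · rintro (rfl | h | h)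
      exacts [hp, h.1, h.1]
  have h1 : {x ∈ edgePoints R a b | p c < x c}.Finite := hfin.subset fun x hx ↦ hx.1
  have h2 : {x ∈ edgePoints R a b | p b' < x b'}.Finite := hfin.subset fun x hx ↦ hx.1
  conv_rhs => rw [hU]
  rw [Set.ncard_insert_of_notMem _ (h1.union h2), Set.ncard_union_eq _ h1 h2]
  · rfl
  · refine Set.disjoint_left.mpr fun x hx hx' ↦ ?_
    have := (hlt x hx.1).mp hx'.2
    exact lt_asymm this hx.2
  · rintro (h | h) <;> exact lt_irrefl _ h.2

/-- The normal arcs at a corner are nested. -/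
theorem nested {a b b' c : Fin 4} (F : FaceFrame a b b' c) {p q x y : Tet}
    (hp : p ∈ edgePoints R a b) (hq : q ∈ edgePoints R a b') (hpq : R a p q)
    (hx : x ∈ edgePoints R a b) (hxy : R a x y) (h : p c < x c) :
    y ∈ edgePoints R a b' ∧ q c < y c := by
  have hpe := hR.isEdgePoint F.hab hp
  have hqe := hR.isEdgePoint F.hab' hq
  have hxe := hR.isEdgePoint F.hab hx
  obtain ⟨e, e', hea, he'a, hee', hxE, hyE⟩ := hR.mem_edgePoints hxy
  obtain rfl := hR.edge_unique F.hab hx hea.symm hxE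
  have hye := hR.isEdgePoint he'a.symm hyE
  rcases hR.disjoint hpq hxy with ⟨rfl, -⟩ | ⟨rfl, -⟩ | hd
  · exact absurd h (lt_irrefl _)
  · exact absurd (hR.edge_unique F.hab hx F.hab' hq) F.hbb'
  · rw [disjoint_seg_iff_side F hpe hqe hx.2.1 hyE.2.1] at hd
    -- The point `x` is on the corner side of the arc from `p` to `q`. By disjointness so is `y`,
    -- which rules out the opposite edge and gives the comparison with `q`.
    have h1 := (side_pos_iff_of_left (q := q) F hpe hxe).mpr h
    have h2 := (pos_iff_pos_of_mul_pos hd).mp h1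
    rcases F.cases e' with rfl | rfl | rfl | rfl
    · exact absurd rfl he'a
    · exact absurd rfl hee'
    · exact ⟨hyE, (side_pos_iff_of_right F hqe hye).mp h2⟩
    · exact absurd h2 (not_lt.mpr (side_of_opposite F hpe hqe hye).le)

/-- In a fixed face each endpoint has only one partner, so joining is injective. -/
theorem ncard_le_of_joined (a : Fin 4) {S S' : Set Tet} (hS' : S'.Finite)
    (h : ∀ x ∈ S, ∃ y ∈ S', R a x y) : S.ncard ≤ S'.ncard := by
  choose! g hg hRg using h
  refine Set.ncard_le_ncard_of_injOn g hg ?_ hS'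
  intro x hx y hy hxy
  refine (hR.unique (hR.symm (hRg x hx)) (hR.symm ?_)).symm
  rw [hxy]
  exact hRg y hy

/-- By nesting, the points nearer to `c` than `p` have partners nearer to `c` than `q`. -/
theorem rank_le_of_joined {a b b' c : Fin 4} (F : FaceFrame a b b' c) {p q : Tet}
    (hp : p ∈ edgePoints R a b) (hq : q ∈ edgePoints R a b') (hpq : R a p q) :
    rank R a b c p ≤ rank R a b' c q := by
  refine hR.ncard_le_of_joined a ((hR.finite_edgePoints a b').subset fun x hx ↦ hx.1) ?_
  rintro x ⟨hx, hpx⟩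
  obtain ⟨e, z, hz⟩ := hx.1
  obtain ⟨y, hxy⟩ := hR.exists_joined hz hx.2.1
  exact ⟨y, hR.nested F hp hq hpq hx hxy hpx, hxy⟩

theorem rank_eq_of_joined {a b b' c : Fin 4} (F : FaceFrame a b b' c) {p q : Tet}
    (hp : p ∈ edgePoints R a b) (hq : q ∈ edgePoints R a b') (hpq : R a p q) :
    rank R a b c p = rank R a b' c q :=
  le_antisymm (hR.rank_le_of_joined F hp hq hpq) (hR.rank_le_of_joined F.symm hq hp (hR.symm hpq))

theorem finite_joinedPoints (a b b' : Fin 4) : (joinedPoints R a b b').Finite :=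
  (hR.finite_edgePoints a b).subset fun _ hx ↦ hx.1

theorem ncard_joinedPoints_comm (a b b' : Fin 4) :
    (joinedPoints R a b b').ncard = (joinedPoints R a b' b).ncard := by
  refine le_antisymm (hR.ncard_le_of_joined a (hR.finite_joinedPoints a b' b) ?_)
    (hR.ncard_le_of_joined a (hR.finite_joinedPoints a b b') ?_)
  all_goals
    rintro x ⟨hx, y, hy, hxy⟩
    exact ⟨y, ⟨hy, x, hx, hR.symm hxy⟩, hxy⟩

theorem ncard_joinedPoints_add {a b b' c : Fin 4} (F : FaceFrame a b b' c) :
    (joinedPoints R a b b').ncard + (joinedPoints R a b c).ncard = (edgePoints R a b).ncard := by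
  rw [← Set.ncard_union_eq ?_ (hR.finite_joinedPoints a b b') (hR.finite_joinedPoints a b c)]
  · congr 1
    ext x
    constructor
    · rintro (h | h) <;> exact h.1
    · intro hx
      obtain ⟨e, z, hz⟩ := hx.1
      obtain ⟨y, hxy⟩ := hR.exists_joined hz hx.2.1
      obtain ⟨e, e', hea, he'a, hee', hxE, hyE⟩ := hR.mem_edgePoints hxy
      obtain rfl := hR.edge_unique F.hab hx hea.symm hxE
      rcases F.cases e' with rfl | rfl | rfl | rfl
      · exact absurd rfl he'a
      · exact absurd rfl hee'
      · exact Or.inl ⟨hx, y, hyE, hxy⟩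
      · exact Or.inr ⟨hx, y, hyE, hxy⟩
  · refine Set.disjoint_left.mpr ?_
    rintro x ⟨-, y, hy, hxy⟩ ⟨-, z, hz, hxz⟩
    obtain rfl := hR.unique hxy hxz
    exact F.hcb' (hR.edge_unique F.hab' hy F.hca.symm hz).symm

/-- Each edge weight of a face is the sum of two corner counts. Solving the three equations shows
that the weights determine the counts. -/
theorem two_mul_ncard_joinedPoints {a b b' c : Fin 4} (F : FaceFrame a b b' c) :
    2 * (joinedPoints R a b b').ncard + (edgePoints R a c).ncard =
      (edgePoints R a b).ncard + (edgePoints R a b').ncard := by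
  have h1 := hR.ncard_joinedPoints_add F
  have h2 := hR.ncard_joinedPoints_add F.symm
  have h3 := hR.ncard_joinedPoints_add (a := a) (b := c) (b' := b) (c := b')
    ⟨F.hca.symm, F.hab, F.hcb, F.hab'.symm, F.hcb'.symm, F.hbb'.symm⟩
  have h4 := hR.ncard_joinedPoints_comm a b b'
  have h5 := hR.ncard_joinedPoints_comm a b c
  have h6 := hR.ncard_joinedPoints_comm a b' c
  omega

/-- Whether a point on an edge is joined across the corner `c` depends only on its rank. -/
theorem mem_joinedPoints_iff {a b b' c : Fin 4} (F : FaceFrame a b b' c) {p : Tet}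
    (hp : p ∈ edgePoints R a b) :
    p ∈ joinedPoints R a b b' ↔ rank R a b c p < (joinedPoints R a b b').ncard := by
  -- By nesting, the joined points form an initial segment when counted from `c`.
  have hup : ∀ x ∈ joinedPoints R a b b', ∀ y ∈ edgePoints R a b, x c < y c →
      y ∈ joinedPoints R a b b' := by
    rintro x ⟨hx, z, hz, hxz⟩ y hy hxy
    obtain ⟨e, w, hw⟩ := hy.1
    obtain ⟨u, hyu⟩ := hR.exists_joined hw hy.2.1
    exact ⟨hy, u, (hR.nested F hx hz hxz hy hyu hxy).1, hyu⟩
  constructor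
  · intro h
    refine Set.ncard_lt_ncard ⟨fun x hx ↦ hup p h x hx.1 hx.2, fun h' ↦ ?_⟩
      (hR.finite_joinedPoints a b b')
    exact lt_irrefl _ (h' h).2
  · intro h
    by_contra hn
    refine absurd h (not_lt.mpr (Set.ncard_le_ncard (fun x hx ↦ ⟨hx.1, ?_⟩)
      ((hR.finite_edgePoints a b).subset fun x hx ↦ hx.1)))
    rcases lt_trichotomy (p c) (x c) with h1 | h1 | h1
    · exact h1
    · exact absurd ((hR.isEdgePoint F.hab hp).ext F (hR.isEdgePoint F.hab hx.1) h1 ▸ hx) hn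
    · exact absurd (hup x hx p hp h1) hn

end IsPattern

/-- Patterns with the same numbers of points on the edges have normally isotopic curves. -/
theorem IsPattern.normallyIsotopic {R R' : Fin 4 → Tet → Tet → Prop} (hR : IsPattern R)
    (hR' : IsPattern R')
    (h : ∀ a b, a ≠ b → (edgePoints R a b).ncard = (edgePoints R' a b).ncard) :
    NormallyIsotopic (curve R) (curve R') := by
  -- The partner `p'` has the rank of `p` on the same edge. It has to serve both ends of the edge
  -- and both orders of its two faces, so that the map `f` does not depend on a frame.
  have hex : ∀ p ∈ points R, ∃ p', ∀ a b b' c, FaceFrame a b b' c → p ∈ edgePoints R a b →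
      p' ∈ edgePoints R' a b ∧ rank R' a b c p' = rank R a b c p := by
    intro p hp
    obtain ⟨a, b, hab, hpE⟩ := hR.exists_edgePoints hp
    obtain ⟨b', hb', hbb'⟩ : ∃ b', b' ≠ a ∧ b' ≠ b := by
      have : ∀ a b : Fin 4, ∃ b', b' ≠ a ∧ b' ≠ b := by decide
      exact this a b
    obtain ⟨c, F⟩ := exists_faceFrame hab.symm hb' hbb'.symm
    obtain ⟨p', hp', hr⟩ := hR'.exists_rank_eq F (h a b hab ▸ hR.rank_lt_ncard (c := c) hpE)
    have F' : FaceFrame a b c b' := ⟨F.hab, F.hca.symm, F.hcb.symm, F.hab'.symm, F.hbb'.symm,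
      F.hcb'.symm⟩
    have hr' : rank R' a b b' p' = rank R a b b' p := by
      have h1 := hR.rank_add_rank F hpE
      have h2 := hR'.rank_add_rank F hp'
      have h3 := h a b hab
      omega
    refine ⟨p', fun x y y' z G hpx ↦ ?_⟩
    have hz : z = c ∨ z = b' := by
      have h1 := (hR.isEdgePoint hab hpE x).mp hpx.2.1
      have h2 := (hR.isEdgePoint hab hpE y).mp hpx.2.2
      have h3 := F.cases z
      have h4 := G.hca
      have h5 := G.hcb
      have h6 := G.hab
      grind
    have hxy : (x = a ∧ y = b) ∨ (x = b ∧ y = a) := by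
      have h1 := (hR.isEdgePoint hab hpE x).mp hpx.2.1
      have h2 := (hR.isEdgePoint hab hpE y).mp hpx.2.2
      have h6 := G.hab
      grind
    rcases hxy with ⟨rfl, rfl⟩ | ⟨rfl, rfl⟩
    · rcases hz with rfl | rfl
      · exact ⟨hp', hr⟩
      · exact ⟨hp', hr'⟩
    · rw [edgePoints_comm, rank_comm R', rank_comm R]
      rcases hz with rfl | rfl
      · exact ⟨hp', hr⟩
      · exact ⟨hp', hr'⟩
  choose! f hf using hex
  have hframe : ∀ a b, a ≠ b → ∀ c, c ≠ a → c ≠ b → ∃ b', FaceFrame a b b' c := by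
    intro a b hab c hca hcb
    obtain ⟨d, h1, h2, h3, -⟩ := exists_fourth a b c hab hca.symm hcb.symm
    exact ⟨d, hab, h1.symm, h2.symm, hca, hcb, h3.symm⟩
  have hfE : ∀ a b, a ≠ b → ∀ p ∈ edgePoints R a b, f p ∈ edgePoints R' a b := by
    intro a b hab p hp
    obtain ⟨c, h1, h2⟩ : ∃ c, c ≠ a ∧ c ≠ b := by
      have : ∀ a b : Fin 4, ∃ b', b' ≠ a ∧ b' ≠ b := by decide
      exact this a b
    obtain ⟨b', F⟩ := hframe a b hab c h1 h2
    exact (hf p hp.1 a b b' c F hp).1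
  have hz : ∀ p ∈ points R, ∀ k, f p k = 0 ↔ p k = 0 := by
    intro p hp k
    obtain ⟨a, b, hab, hpE⟩ := hR.exists_edgePoints hp
    rw [hR'.isEdgePoint hab (hfE a b hab p hpE), hR.isEdgePoint hab hpE]
  have hmoves : MovesAlongEdges R f := by
    refine ⟨hz, fun p hp q hq hpq k hlt ↦ ?_⟩
    obtain ⟨a, b, hab, hpE⟩ := hR.exists_edgePoints hp
    have hqE : q ∈ edgePoints R a b := ⟨hq, (hpq a).mp hpE.2.1, (hpq b).mp hpE.2.2⟩
    have hka : k ≠ a := by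
      rintro rfl
      rw [hpE.2.1, hqE.2.1] at hlt
      exact lt_irrefl _ hlt
    have hkb : k ≠ b := by
      rintro rfl
      rw [hpE.2.2, hqE.2.2] at hlt
      exact lt_irrefl _ hlt
    obtain ⟨b', F⟩ := hframe a b hab k hka hkb
    obtain ⟨h1, h2⟩ := hf p hp a b b' k F hpE
    obtain ⟨h3, h4⟩ := hf q hq a b b' k F hqE
    refine hR'.lt_of_rank_lt h1 ?_
    rw [h2, h4]
    exact hR.rank_lt_rank hqE hlt
  refine hmoves.normallyIsotopic hR hR' ?_ ?_
  · intro a p q hpq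
    obtain ⟨b, b', hb, hb', hbb', hp, hq⟩ := hR.mem_edgePoints hpq
    obtain ⟨c, F⟩ := exists_faceFrame hb hb' hbb'
    obtain ⟨h1, h2⟩ := hf p hp.1 a b b' c F hp
    obtain ⟨h3, h4⟩ := hf q hq.1 a b' b c F.symm hq
    -- Equal edge weights give equal corner counts, so by its rank `f p` is joined across the same
    -- corner as `p`; the rank of its partner then identifies the partner as `f q`.
    have hcard : (joinedPoints R a b b').ncard = (joinedPoints R' a b b').ncard := by
      have h5 := hR.two_mul_ncard_joinedPoints F
      have h6 := hR'.two_mul_ncard_joinedPoints F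
      have h7 := h a b F.hab
      have h8 := h a b' F.hab'
      have h9 := h a c F.hca.symm
      omega
    have hmem : f p ∈ joinedPoints R' a b b' := by
      rw [hR'.mem_joinedPoints_iff F h1, h2, ← hcard, ← hR.mem_joinedPoints_iff F hp]
      exact ⟨hp, q, hq, hpq⟩
    obtain ⟨-, y, hy, hfy⟩ := hmem
    have : y = f q := by
      refine hR'.eq_of_rank_eq F.symm hy h3 ?_
      rw [← hR'.rank_eq_of_joined F h1 hy hfy, h2, h4, hR.rank_eq_of_joined F hp hq hpq]
    exact this ▸ hfy
  · intro p' hp'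
    obtain ⟨a, b, hab, hpE'⟩ := hR'.exists_edgePoints hp'
    obtain ⟨c, h1, h2⟩ : ∃ c, c ≠ a ∧ c ≠ b := by
      have : ∀ a b : Fin 4, ∃ b', b' ≠ a ∧ b' ≠ b := by decide
      exact this a b
    obtain ⟨b', F⟩ := hframe a b hab c h1 h2
    obtain ⟨p, hp, hr⟩ := hR.exists_rank_eq F ((h a b hab).symm ▸ hR'.rank_lt_ncard (c := c) hpE')
    obtain ⟨h3, h4⟩ := hf p hp.1 a b b' c F hp
    exact ⟨p, hp.1, hR'.eq_of_rank_eq F h3 hpE' (h4.trans hr)⟩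

end Ranks

/-! ### Parallel copies of the loops of a pattern. -/

section ParallelCopies

/-- The restriction of a pattern to the arcs with endpoints in `S`. -/
def restrict (R : Fin 4 → Tet → Tet → Prop) (S : Set Tet) (a : Fin 4) (p q : Tet) : Prop :=
  R a p q ∧ p ∈ S

theorem IsPattern.restrict {R : Fin 4 → Tet → Tet → Prop} (hR : IsPattern R) {S : Set Tet}
    (hS : ∀ a p q, R a p q → p ∈ S → q ∈ S) : IsPattern (restrict R S) where
  finite := hR.finite.subset fun p ⟨a, q, h⟩ ↦ ⟨a, q, h.1⟩
  edge h := hR.edge h.1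
  symm h := ⟨hR.symm h.1, hS _ _ _ h.1 h.2⟩
  exists_joined h h0 := by
    obtain ⟨q', h'⟩ := hR.exists_joined h.1 h0
    exact ⟨q', h', h.2⟩
  disjoint h h' := hR.disjoint h.1 h'.1

theorem points_restrict (R : Fin 4 → Tet → Tet → Prop) (S : Set Tet) :
    points (restrict R S) = points R ∩ S := by
  ext p
  constructor
  · rintro ⟨a, q, h, hp⟩
    exact ⟨⟨a, q, h⟩, hp⟩
  · rintro ⟨⟨a, q, h⟩, hp⟩
    exact ⟨a, q, h, hp⟩

theorem edgePoints_restrict (R : Fin 4 → Tet → Tet → Prop) (S : Set Tet) (a b : Fin 4) :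
    edgePoints (restrict R S) a b = edgePoints R a b ∩ S := by
  ext p
  simp only [edgePoints, points_restrict, Set.mem_inter_iff, Set.mem_ofPred_eq]
  tauto

theorem curve_restrict_union (R : Fin 4 → Tet → Tet → Prop) (S : Set Tet) :
    curve (restrict R S) ∪ curve (restrict R Sᶜ) = curve R := by
  ext x
  constructor
  · rintro (⟨a, p, q, h, hx⟩ | ⟨a, p, q, h, hx⟩) <;> exact ⟨a, p, q, h.1, hx⟩
  · rintro ⟨a, p, q, h, hx⟩
    by_cases hp : p ∈ S
    · exact Or.inl ⟨a, p, q, ⟨h, hp⟩, hx⟩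
    · exact Or.inr ⟨a, p, q, ⟨h, hp⟩, hx⟩

theorem IsPattern.disjoint_curve_restrict {R : Fin 4 → Tet → Tet → Prop} (hR : IsPattern R)
    {S : Set Tet} (hS : ∀ a p q, R a p q → p ∈ S → q ∈ S) :
    Disjoint (curve (GluingDistance.restrict R S)) (curve (GluingDistance.restrict R Sᶜ)) := by
  refine Set.disjoint_left.mpr ?_
  rintro x ⟨a, p, q, ⟨h, hp⟩, hx⟩ ⟨a', p', q', ⟨h', hp'⟩, hx'⟩
  have hq := hS a p q h hp
  have hq' : q' ∉ S := fun hq' ↦ hp' (hS a' q' p' (hR.symm h') hq')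
  by_cases haa' : a = a'
  · subst haa'
    rcases hR.disjoint h h' with ⟨rfl, rfl⟩ | ⟨rfl, rfl⟩ | hd
    · exact hp' hp
    · exact hp' hq
    · exact Set.disjoint_left.mp hd hx hx'
  · rcases hR.eq_endpoint h hx (Ne.symm haa') (hR.zero h' hx') with rfl | rfl <;>
      rcases hR.eq_endpoint h' hx' haa' (hR.zero h hx) with rfl | rfl
    exacts [hp' hp, hq' hp, hp' hq, hq' hq]

/-- `n` numbers at distances `2 * ε`, symmetric with respect to `0`. -/
def offsets (ε : ℝ) (n : ℕ) : Finset ℝ := (Finset.range n).image fun k : ℕ ↦ ε * (2 * k + 1 - n)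

theorem card_offsets {ε : ℝ} (hε : 0 < ε) (n : ℕ) : (offsets ε n).card = n := by
  rw [offsets, Finset.card_image_of_injective, Finset.card_range]
  intro k l h
  have := mul_left_cancel₀ hε.ne' h
  have : (k : ℝ) = l := by linarith
  exact_mod_cast this

/-- Sliding a point along its edge changes the two nonzero coordinates by opposite amounts. Symmetry
of the offsets lets `IsCopy` treat both coordinates alike. -/
theorem neg_mem_offsets {ε u : ℝ} {n : ℕ} (hu : u ∈ offsets ε n) : -u ∈ offsets ε n := by
  simp only [offsets, Finset.mem_image, Finset.mem_range] at hu ⊢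
  obtain ⟨k, hk, rfl⟩ := hu
  refine ⟨n - 1 - k, by omega, ?_⟩
  have : ((n - 1 - k : ℕ) : ℝ) = n - 1 - k := by
    rw [Nat.sub_sub, Nat.cast_sub (by omega)]
    push_cast
    ring
  rw [this]
  ring

theorem abs_le_of_mem_offsets {ε u : ℝ} (hε : 0 < ε) {n : ℕ} (hu : u ∈ offsets ε n) :
    |u| ≤ ε * n := by
  simp only [offsets, Finset.mem_image, Finset.mem_range] at hu
  obtain ⟨k, hk, rfl⟩ := hu
  rw [abs_mul, abs_of_pos hε]
  refine mul_le_mul_of_nonneg_left ?_ hε.le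
  have : (k : ℝ) + 1 ≤ n := by exact_mod_cast hk
  have h0 : (0 : ℝ) ≤ k := Nat.cast_nonneg k
  rw [abs_le]
  constructor <;> linarith

/-- `x` is one of the `m p` copies of the point `p` of a pattern. -/
def IsCopy (ε : ℝ) (m : Tet → ℕ) (p x : Tet) : Prop :=
  (∀ k, x k = 0 ↔ p k = 0) ∧ ∀ k, p k ≠ 0 → x k - p k ∈ offsets ε (m p)

/-- The arcs of a pattern are replaced with parallel copies. -/
def parallel (ε : ℝ) (m : Tet → ℕ) (R : Fin 4 → Tet → Tet → Prop) (a : Fin 4) (x y : Tet) : Prop :=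
  ∃ p q, R a p q ∧ IsCopy ε m p x ∧ IsCopy ε m q y ∧
    ∀ c, p c ≠ 0 → q c ≠ 0 → x c - p c = y c - q c

/-- `ε` is so small that the copies of different points are in the same order as the points. -/
structure IsSmall (ε : ℝ) (m : Tet → ℕ) (R : Fin 4 → Tet → Tet → Prop) : Prop where
  pos : 0 < ε
  lt : ∀ p ∈ points R, ∀ k, p k ≠ 0 → ε * m p < p k
  gap : ∀ p ∈ points R, ∀ q ∈ points R, ∀ k, p k < q k → p k + ε * m p < q k - ε * m q

/-- Finitely many strict inequalities, continuous in `ε`, hold at `ε = 0` and hence for small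
positive `ε`. -/
theorem IsPattern.exists_isSmall {R : Fin 4 → Tet → Tet → Prop} (hR : IsPattern R)
    (m : Tet → ℕ) : ∃ ε, IsSmall ε m R := by
  have h1 : ∀ᶠ ε : ℝ in nhdsWithin 0 (Set.Ioi 0), 0 < ε := eventually_mem_nhdsWithin
  have h2 : ∀ᶠ ε : ℝ in nhdsWithin 0 (Set.Ioi 0), ∀ p ∈ points R, ∀ k, p k ≠ 0 → ε * m p < p k := by
    refine nhdsWithin_le_nhds ((Filter.eventually_all_finite hR.finite).mpr fun p _ ↦
      Filter.eventually_all.mpr fun k ↦ ?_)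
    by_cases hk : p k = 0
    · exact Filter.Eventually.of_forall fun ε h ↦ absurd hk h
    · have hc : Continuous fun ε : ℝ ↦ ε * m p := by fun_prop
      have := hc.continuousAt.eventually_lt (continuousAt_const (y := p k))
        (x₀ := 0) (by simpa using (tet_nonneg p k).lt_of_ne' hk)
      exact this.mono fun ε h _ ↦ h
  have h3 : ∀ᶠ ε : ℝ in nhdsWithin 0 (Set.Ioi 0), ∀ p ∈ points R, ∀ q ∈ points R, ∀ k, p k < q k →
      p k + ε * m p < q k - ε * m q := by
    refine nhdsWithin_le_nhds ((Filter.eventually_all_finite hR.finite).mpr fun p _ ↦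
      (Filter.eventually_all_finite hR.finite).mpr fun q _ ↦
      Filter.eventually_all.mpr fun k ↦ ?_)
    by_cases hk : p k < q k
    · have hc : Continuous fun ε : ℝ ↦ p k + ε * m p := by fun_prop
      have hc' : Continuous fun ε : ℝ ↦ q k - ε * m q := by fun_prop
      have := hc.continuousAt.eventually_lt (hc'.continuousAt (x := 0)) (by simpa using hk)
      exact this.mono fun ε h _ ↦ h
    · exact Filter.Eventually.of_forall fun ε h ↦ absurd h hk
  obtain ⟨ε, h⟩ := (h1.and (h2.and h3)).exists
  exact ⟨ε, h.1, h.2.1, h.2.2⟩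

namespace IsSmall

variable {ε : ℝ} {m : Tet → ℕ} {R : Fin 4 → Tet → Tet → Prop} (hε : IsSmall ε m R)

include hε

theorem abs_sub_le {p x : Tet} (h : IsCopy ε m p x) (k : Fin 4) : |x k - p k| ≤ ε * m p := by
  by_cases hk : p k = 0
  · rw [(h.1 k).mpr hk, hk, sub_zero, abs_zero]
    exact mul_nonneg hε.pos.le (Nat.cast_nonneg _)
  · exact abs_le_of_mem_offsets hε.pos (h.2 k hk)

theorem copy_lt_copy {p q x y : Tet} (hp : p ∈ points R) (hq : q ∈ points R)
    (hx : IsCopy ε m p x) (hy : IsCopy ε m q y) {k : Fin 4} (h : p k < q k) : x k < y k := by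
  have h1 := abs_le.mp (hε.abs_sub_le hx k)
  have h2 := abs_le.mp (hε.abs_sub_le hy k)
  have h3 := hε.gap p hp q hq k h
  linarith [h1.2, h2.1]

theorem orderTransfers {p q x y : Tet} (hp : p ∈ points R) (hq : q ∈ points R)
    (hx : IsCopy ε m p x) (hy : IsCopy ε m q y) : OrderTransfers p x q y :=
  fun _ _ ↦ ⟨hε.copy_lt_copy hp hq hx hy, hε.copy_lt_copy hq hp hy hx⟩

theorem copy_unique {p q x : Tet} (hp : p ∈ points R) (hq : q ∈ points R)
    (hx : IsCopy ε m p x) (hy : IsCopy ε m q x) : p = q := by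
  refine tet_ext fun k ↦ ?_
  rcases lt_trichotomy (p k) (q k) with h | h | h
  · exact absurd (hε.copy_lt_copy hp hq hx hy h) (lt_irrefl _)
  · exact h
  · exact absurd (hε.copy_lt_copy hq hp hy hx h) (lt_irrefl _)

theorem exists_copy {a b b' c : Fin 4} (F : FaceFrame a b b' c) {p : Tet} (hp : p ∈ points R)
    (hpe : IsEdgePoint a b p) {u : ℝ} (hu : u ∈ offsets ε (m p)) :
    ∃ x, IsCopy ε m p x ∧ x c - p c = u := by
  have hpc := hpe.pos F.hca F.hcb
  have hpb := hpe.pos F.hab'.symm F.hbb'.symm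
  have h1 := hε.lt p hp c hpc.ne'
  have h2 := hε.lt p hp b' hpb.ne'
  have h3 := abs_le.mp (abs_le_of_mem_offsets hε.pos hu)
  have hc0 : 0 < p c + u := by linarith [h3.1]
  have hb0 : 0 < p b' - u := by linarith [h3.2]
  let f : Fin 4 → ℝ := fun k ↦ if k = c then p c + u else if k = b' then p b' - u else 0
  have hfc : f c = p c + u := by simp [f]
  have hfb' : f b' = p b' - u := by simp [f, F.hcb'.symm]
  have hfa : f a = 0 := by simp [f, F.hca.symm, F.hab']
  have hfb : f b = 0 := by simp [f, F.hcb.symm, F.hbb']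
  have hs := F.sum hpe.zero_left
  rw [hpe.zero_right] at hs
  have hf : f ∈ stdSimplex ℝ (Fin 4) := by
    refine ⟨fun k ↦ ?_, ?_⟩
    · rcases F.cases k with rfl | rfl | rfl | rfl
      · exact hfa.ge
      · exact hfb.ge
      · exact hfb' ▸ hb0.le
      · exact hfc ▸ hc0.le
    · rw [← sum_four f a b b' c F.hab F.hab' F.hbb' F.hca F.hcb F.hcb', hfa, hfb, hfb', hfc]
      linarith
  refine ⟨⟨f, hf⟩, ⟨fun k ↦ ?_, fun k hk ↦ ?_⟩, ?_⟩
  · change f k = 0 ↔ _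
    rcases F.cases k with rfl | rfl | rfl | rfl
    · simp [hfa, hpe.zero_left]
    · simp [hfb, hpe.zero_right]
    · rw [hfb']
      exact iff_of_false hb0.ne' hpb.ne'
    · rw [hfc]
      exact iff_of_false hc0.ne' hpc.ne'
  · change f k - p k ∈ _
    rcases F.cases k with rfl | rfl | rfl | rfl
    · exact absurd hpe.zero_left hk
    · exact absurd hpe.zero_right hk
    · rw [hfb', show p k - u - p k = -u by ring]
      exact neg_mem_offsets hu
    · rw [hfc, add_sub_cancel_left]
      exact hu
  · change f c - p c = u
    rw [hfc]
    ring

theorem bijOn_copies {a b b' c : Fin 4} (F : FaceFrame a b b' c) {p : Tet} (hp : p ∈ points R)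
    (hpe : IsEdgePoint a b p) :
    Set.BijOn (fun x : Tet ↦ x c - p c) {x | IsCopy ε m p x} (offsets ε (m p)) := by
  refine ⟨fun x hx ↦ hx.2 c (hpe.pos F.hca F.hcb).ne', fun x hx y hy hxy ↦ ?_, fun u hu ↦ ?_⟩
  · exact (hpe.congr hx.1).ext F (hpe.congr hy.1) (sub_left_injective hxy)
  · obtain ⟨x, hx, h⟩ := hε.exists_copy F hp hpe hu
    exact ⟨x, hx, h⟩

theorem finite_copies (hR : IsPattern R) {p : Tet} (hp : p ∈ points R) :
    {x | IsCopy ε m p x}.Finite := by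
  obtain ⟨a, q, h⟩ := id hp
  obtain ⟨b, b', hb, hb', hbb', hpe, -⟩ := hR.edge h
  obtain ⟨c, F⟩ := exists_faceFrame hb hb' hbb'
  exact (hε.bijOn_copies F hp hpe).finite_iff_finite.mpr (Finset.finite_toSet _)

theorem ncard_copies (hR : IsPattern R) {p : Tet} (hp : p ∈ points R) :
    {x | IsCopy ε m p x}.ncard = m p := by
  obtain ⟨a, q, h⟩ := id hp
  obtain ⟨b, b', hb, hb', hbb', hpe, -⟩ := hR.edge h
  obtain ⟨c, F⟩ := exists_faceFrame hb hb' hbb'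
  have hbij := hε.bijOn_copies F hp hpe
  rw [← hbij.injOn.ncard_image, hbij.image_eq, Set.ncard_coe_finset, card_offsets hε.pos]

omit hε in
-- Copies of one arc are displaced towards the corner `c` by the same amount at both ends. Two of
-- them therefore have the same order at both ends and are nested.
theorem parallel_disjoint_or_eq (hR : IsPattern R) {a : Fin 4} {p q x y x' y' : Tet} (h : R a p q)
    (hx : IsCopy ε m p x) (hy : IsCopy ε m q y)
    (hxy : ∀ c, p c ≠ 0 → q c ≠ 0 → x c - p c = y c - q c)
    (hx' : IsCopy ε m p x') (hy' : IsCopy ε m q y')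
    (hxy' : ∀ c, p c ≠ 0 → q c ≠ 0 → x' c - p c = y' c - q c) :
    (x' = x ∧ y' = y) ∨ Disjoint (seg x y) (seg x' y') := by
  obtain ⟨b, b', hb, hb', hbb', hp, hq⟩ := hR.edge h
  obtain ⟨c, F⟩ := exists_faceFrame hb hb' hbb'
  have h1 := hxy c (hp.pos F.hca F.hcb).ne' (hq.pos F.hca F.hcb').ne'
  have h2 := hxy' c (hp.pos F.hca F.hcb).ne' (hq.pos F.hca F.hcb').ne'
  have hxe := hp.congr hx.1
  have hxe' := hp.congr hx'.1
  have hye := hq.congr hy.1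
  have hye' := hq.congr hy'.1
  rw [disjoint_seg_iff_side F hxe hye hxe'.zero_left hye'.zero_left]
  rcases lt_trichotomy (x c) (x' c) with h3 | h3 | h3
  · exact Or.inr (mul_pos ((side_pos_iff_of_left F hxe hxe').mpr h3)
      ((side_pos_iff_of_right F hye hye').mpr (by linarith)))
  · exact Or.inl ⟨hxe'.ext F hxe h3.symm, hye'.ext F.symm hye (by linarith)⟩
  · exact Or.inr (mul_pos_of_neg_of_neg ((side_neg_iff_of_left F hxe hxe').mpr h3)
      ((side_neg_iff_of_right F hye hye').mpr (by linarith)))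

theorem isPattern_parallel (hR : IsPattern R) (hm : ∀ a p q, R a p q → m p = m q) :
    IsPattern (parallel ε m R) where
  finite := by
    refine (hR.finite.biUnion fun p hp ↦ hε.finite_copies hR hp).subset ?_
    rintro x ⟨a, y, p, q, h, hx, -⟩
    exact Set.mem_biUnion (show p ∈ points R from ⟨a, q, h⟩) hx
  edge := by
    rintro a x y ⟨p, q, h, hx, hy, -⟩
    obtain ⟨b, b', hb, hb', hbb', hp, hq⟩ := hR.edge h
    exact ⟨b, b', hb, hb', hbb', hp.congr hx.1, hq.congr hy.1⟩
  symm := by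
    rintro a x y ⟨p, q, h, hx, hy, hxy⟩
    exact ⟨q, p, hR.symm h, hy, hx, fun c h1 h2 ↦ (hxy c h2 h1).symm⟩
  exists_joined := by
    rintro a x y a' ⟨p, q, h, hx, hy, hxy⟩ hxa'
    obtain ⟨q', h'⟩ := hR.exists_joined h ((hx.1 a').mp hxa')
    obtain ⟨b, b', hb, hb', hbb', hp, hq⟩ := hR.edge h'
    obtain ⟨c, F⟩ := exists_faceFrame hb hb' hbb'
    have hu := hx.2 c (hp.pos F.hca F.hcb).ne'
    -- The arc continues with the same displacement. This offset is available at the other endpoint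
    -- because both endpoints have the same multiplicity.
    rw [hm a' p q' h'] at hu
    obtain ⟨z, hz, hzc⟩ := hε.exists_copy F.symm ⟨a', p, hR.symm h'⟩ hq hu
    refine ⟨z, p, q', h', hx, hz, fun k h1 h2 ↦ ?_⟩
    rcases F.cases k with rfl | rfl | rfl | rfl
    · exact absurd hp.zero_left h1
    · exact absurd hp.zero_right h1
    · exact absurd hq.zero_right h2
    · exact hzc.symm
  disjoint := by
    rintro a x y x' y' ⟨p, q, h, hx, hy, hxy⟩ ⟨p', q', h', hx', hy', hxy'⟩
    rcases hR.disjoint h h' with ⟨rfl, rfl⟩ | ⟨rfl, rfl⟩ | hd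
    · rcases parallel_disjoint_or_eq hR h hx hy hxy hx' hy' hxy' with h1 | h1
      · exact Or.inl h1
      · exact Or.inr (Or.inr h1)
    · rcases parallel_disjoint_or_eq hR h hx hy hxy hy' hx'
        (fun c h1 h2 ↦ (hxy' c h2 h1).symm) with h1 | h1
      · exact Or.inr (Or.inl ⟨h1.2, h1.1⟩)
      · exact Or.inr (Or.inr (seg_comm x' y' ▸ h1))
    · obtain ⟨b, b', hb, hb', hbb', hp, hq⟩ := hR.edge h
      obtain ⟨e, e', hea, he'a, hee', hp', hq'⟩ := hR.edge h'
      have hpP : p ∈ points R := ⟨a, q, h⟩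
      have hqP : q ∈ points R := ⟨a, p, hR.symm h⟩
      have hpP' : p' ∈ points R := ⟨a, q', h'⟩
      have hqP' : q' ∈ points R := ⟨a, p', hR.symm h'⟩
      -- Copies of different arcs inherit disjointness, since `ε` is too small to change the order
      -- of points on an edge.
      exact Or.inr (Or.inr (disjoint_seg_transfers hb hb' hbb' hea he'a hp hq hp' hq'
        (hp.congr hx.1) (hq.congr hy.1) (hp'.congr hx'.1) (hq'.congr hy'.1)
        (hε.orderTransfers hpP hpP' hx hx') (hε.orderTransfers hqP hpP' hy hx')
        (hε.orderTransfers hpP hqP' hx hy') (hε.orderTransfers hqP hqP' hy hy') hd))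

theorem mem_points_parallel (hR : IsPattern R) (hm : ∀ a p q, R a p q → m p = m q) {x : Tet} :
    x ∈ points (parallel ε m R) ↔ ∃ p ∈ points R, IsCopy ε m p x := by
  constructor
  · rintro ⟨a, y, p, q, h, hx, -⟩
    exact ⟨p, ⟨a, q, h⟩, hx⟩
  · rintro ⟨p, ⟨a, q, h⟩, hx⟩
    obtain ⟨b, b', hb, hb', hbb', hp, hq⟩ := hR.edge h
    obtain ⟨c, F⟩ := exists_faceFrame hb hb' hbb'
    have hu := hx.2 c (hp.pos F.hca F.hcb).ne'
    rw [hm a p q h] at hu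
    obtain ⟨z, hz, hzc⟩ := hε.exists_copy F.symm ⟨a, p, hR.symm h⟩ hq hu
    refine ⟨a, z, p, q, h, hx, hz, fun k h1 h2 ↦ ?_⟩
    rcases F.cases k with rfl | rfl | rfl | rfl
    · exact absurd hp.zero_left h1
    · exact absurd hp.zero_right h1
    · exact absurd hq.zero_right h2
    · exact hzc.symm

end IsSmall

/-- A pattern whose arcs are coloured with two colours, given by `S` and its complement, can be
replaced with two disjoint patterns that consist of `m p` parallel copies of the arcs with
endpoint `p`. -/
theorem IsPattern.exists_parallel_copies {R : Fin 4 → Tet → Tet → Prop} (hR : IsPattern R)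
    {m : Tet → ℕ} (hm : ∀ a p q, R a p q → m p = m q) {S : Set Tet}
    (hS : ∀ a p q, R a p q → p ∈ S → q ∈ S) :
    ∃ R₁ R₂, IsPattern R₁ ∧ IsPattern R₂ ∧ Disjoint (curve R₁) (curve R₂) ∧
      IsStraightNormalCurve (curve R₁ ∪ curve R₂) ∧ ∀ a b,
        (edgePoints R₁ a b).ncard = ∑ᶠ p ∈ edgePoints R a b ∩ S, m p ∧
        (edgePoints R₂ a b).ncard = ∑ᶠ p ∈ edgePoints R a b ∩ Sᶜ, m p := by
  obtain ⟨ε, hε⟩ := hR.exists_isSmall m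
  have hP := hε.isPattern_parallel hR hm
  -- The copies inherit the colours of the original points.
  let T : Set Tet := {x | ∃ p ∈ points R, p ∈ S ∧ IsCopy ε m p x}
  have hT : ∀ a x y, parallel ε m R a x y → x ∈ T → y ∈ T := by
    rintro a x y ⟨p, q, h, hx, hy, -⟩ ⟨r, hr, hrS, hxr⟩
    obtain rfl := hε.copy_unique ⟨a, q, h⟩ hr hx hxr
    exact ⟨q, ⟨a, p, hR.symm h⟩, hS a p q h hrS, hy⟩
  have hT' : ∀ a x y, parallel ε m R a x y → x ∈ Tᶜ → y ∈ Tᶜ :=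
    fun a x y h hx hy ↦ hx (hT a y x (hP.symm h) hy)
  have hcount : ∀ A a b, A ⊆ edgePoints R a b →
      {x | ∃ p ∈ A, IsCopy ε m p x}.ncard = ∑ᶠ p ∈ A, m p := by
    intro A a b hA
    have hU : {x | ∃ p ∈ A, IsCopy ε m p x} = ⋃ p ∈ A, {x | IsCopy ε m p x} := by
      ext x
      simp
    have hAf : A.Finite := (hR.finite_edgePoints a b).subset hA
    rw [hU, hAf.ncard_biUnion fun p hp ↦ hε.finite_copies hR (hA hp).1]
    · exact finsum_mem_congr rfl fun p hp ↦ hε.ncard_copies hR (hA hp).1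
    · intro p hp q hq hne
      exact Set.disjoint_left.mpr fun x hx hy ↦
        hne (hε.copy_unique (hA hp).1 (hA hq).1 hx hy)
  refine ⟨_, _, hP.restrict hT, hP.restrict hT', hP.disjoint_curve_restrict hT, ?_, fun a b ↦ ?_⟩
  · rw [curve_restrict_union]
    exact hP.isStraightNormalCurve
  · rw [← hcount _ a b Set.inter_subset_left, ← hcount _ a b Set.inter_subset_left,
      edgePoints_restrict, edgePoints_restrict]
    constructor
    · congr 1
      ext x
      constructor
      · rintro ⟨hx, p, hp, hpS, hpx⟩
        exact ⟨p, ⟨⟨hp, (hpx.1 a).mp hx.2.1, (hpx.1 b).mp hx.2.2⟩, hpS⟩, hpx⟩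
      · rintro ⟨p, ⟨hp, hpS⟩, hpx⟩
        exact ⟨⟨(hε.mem_points_parallel hR hm).mpr ⟨p, hp.1, hpx⟩, (hpx.1 a).mpr hp.2.1,
          (hpx.1 b).mpr hp.2.2⟩, p, hp.1, hpS, hpx⟩
    · congr 1
      ext x
      constructor
      · rintro ⟨hx, hxT⟩
        obtain ⟨p, hp, hpx⟩ := (hε.mem_points_parallel hR hm).mp hx.1
        exact ⟨p, ⟨⟨hp, (hpx.1 a).mp hx.2.1, (hpx.1 b).mp hx.2.2⟩, fun hpS ↦ hxT ⟨p, hp, hpS, hpx⟩⟩,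
          hpx⟩
      · rintro ⟨p, ⟨hp, hpS⟩, hpx⟩
        refine ⟨⟨(hε.mem_points_parallel hR hm).mpr ⟨p, hp.1, hpx⟩, (hpx.1 a).mpr hp.2.1,
          (hpx.1 b).mpr hp.2.2⟩, ?_⟩
        rintro ⟨q, hq, hqS, hqx⟩
        exact hpS (hε.copy_unique hq hp.1 hqx hpx ▸ hqS)

end ParallelCopies

/-! ### Compatibility depends only on the weights of the loops. -/

section Compatibility

theorem CanBeMadeDisjoint.symm {K K' : Set Tet} (h : CanBeMadeDisjoint K K') :
    CanBeMadeDisjoint K' K := by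
  obtain ⟨L, L', h1, h2, h3, h4⟩ := h
  exact ⟨L', L, h2, h1, h3.symm, Set.union_comm L L' ▸ h4⟩

theorem IsPattern.seg_subset_of_mem {R : Fin 4 → Tet → Tet → Prop} {X Y : Set Tet}
    (hX : IsClosed X) (hY : IsClosed Y) (hd : Disjoint X Y) (hXY : X ∪ Y = curve R) {a : Fin 4}
    {p q x : Tet} (h : R a p q) (hx : x ∈ seg p q) (hxX : x ∈ X) : seg p q ⊆ X := by
  have hsub : seg p q ⊆ X ∪ Y := hXY ▸ fun y hy ↦ ⟨a, p, q, h, hy⟩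
  rcases (isPreconnected_iff_subset_of_disjoint_closed.mp (isPreconnected_seg p q)) X Y hX hY hsub
    (by rw [hd.inter_eq, Set.inter_empty]) with h1 | h1
  · exact h1
  · exact absurd (h1 hx) (Set.disjoint_left.mp hd hxX)

/-- Whether a normal curve can be made disjoint from another one depends only on the edge weights
of its loops, not on their multiplicities. -/
theorem CanBeMadeDisjoint.of_loops {K K' G : Set Tet} (h : CanBeMadeDisjoint K' G)
    (hK : IsCompact K) (hK' : IsCompact K') (hG : IsCompact G) (hnormal : IsNormalCurve K)
    (hloops : ∀ L ∈ loops K, ∃ L' ∈ loops K', ∀ a b, a ≠ b → edgeWeight L a b = edgeWeight L' a b) :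
    CanBeMadeDisjoint K G := by
  classical
  obtain ⟨L, L', hKL, hGL, hd, K₁, hK₁, hiso⟩ := h
  obtain ⟨X, Y, hLX, hLY, hXYd, rfl⟩ := hiso.exists_disjoint_images hd
  obtain ⟨R, hR, hXY⟩ := hK₁.exists_pattern
  have hX := (hKL.trans hLX).isCompact hK'
  have hY := (hGL.trans hLY).isCompact hG
  have hseg : ∀ {a p q x}, R a p q → x ∈ seg p q → x ∈ X → seg p q ⊆ X :=
    IsPattern.seg_subset_of_mem hX.isClosed hY.isClosed hXYd hXY.symm
  have hS : ∀ a p q, R a p q → p ∈ X → q ∈ X := fun a p q h hp ↦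
    hseg h (left_mem_seg p q) hp (right_mem_seg p q)
  obtain ⟨K₀, hK₀, hKK₀⟩ := hnormal
  obtain ⟨R₀, hR₀, rfl⟩ := hK₀.exists_pattern
  -- Each loop of the straightened `K` is modelled by a loop of `X`, the straight position of `K'`,
  -- with the same edge weights.
  have hπ : ∀ L ∈ loops (curve R₀), ∃ L' ∈ loops X, ∀ a b, a ≠ b →
      edgeWeight L a b = edgeWeight L' a b := by
    intro L₀ hL₀
    obtain ⟨f, hf⟩ := hKK₀.exists_homeomorph hK
    obtain ⟨g, hg⟩ := (hKL.trans hLX).exists_homeomorph hK'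
    obtain ⟨L₁, hL₁, h1⟩ := exists_loop_of_homeomorph f.symm
      (fun x a ↦ by rw [← hf, f.apply_symm_apply]) hL₀
    obtain ⟨L₂, hL₂, h2⟩ := hloops L₁ hL₁
    obtain ⟨L₃, hL₃, h3⟩ := exists_loop_of_homeomorph g hg hL₂
    exact ⟨L₃, hL₃, fun a b hab ↦ by rw [h1, h2 a b hab, h3]⟩
  choose! π hπX hπw using hπ
  -- A loop of `X` is copied once for each loop of `curve R₀` that it models, and disappears if
  -- there is none. The points outside `X`, which belong to the position `Y` of `G`, keep
  -- multiplicity one.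
  let m : Tet → ℕ := fun p ↦ if p ∈ X then {L ∈ loops (curve R₀) | p ∈ π L}.ncard else 1
  have hm : ∀ a p q, R a p q → m p = m q := by
    intro a p q h
    by_cases hp : p ∈ X
    · simp only [m, if_pos hp, if_pos (hS a p q h hp)]
      congr 1
      ext L
      refine and_congr_right fun hL ↦ ?_
      have hsub := hseg h (left_mem_seg p q) hp
      exact ⟨fun h1 ↦ IsPreconnected.subset_loop (isPreconnected_seg p q) hsub (hπX L hL)
          (left_mem_seg p q) h1 (right_mem_seg p q),
        fun h1 ↦ IsPreconnected.subset_loop (isPreconnected_seg p q) hsub (hπX L hL)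
          (right_mem_seg p q) h1 (left_mem_seg p q)⟩
    · have hq : q ∉ X := fun hq ↦ hp (hS a q p (hR.symm h) hq)
      simp only [m, if_neg hp, if_neg hq]
  obtain ⟨R₁, R₂, hR₁, hR₂, hdis, hstraight, hcount⟩ := hR.exists_parallel_copies hm hS
  refine ⟨curve R₁, curve R₂, hKK₀.trans (hR₀.normallyIsotopic hR₁ fun a b hab ↦ ?_),
    (hGL.trans hLY).trans ?_, hdis, _, hstraight, NormallyIsotopic.refl _⟩
  · have hfin : (edgePoints R a b ∩ X).Finite := (hR.finite_edgePoints a b).inter_of_left X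
    have hloop : ∀ L ∈ loops (curve R₀), edgeWeight L a b =
        (hfin.toFinset.filter fun p ↦ p ∈ π L).card := by
      intro L hL
      rw [hπw L hL a b hab, edgeWeight, ← Set.ncard_coe_finset]
      congr 1
      ext x
      simp only [Finset.coe_filter, Set.Finite.mem_toFinset, Set.mem_inter_iff, Set.mem_ofPred_eq]
      constructor
      · rintro ⟨hx, h⟩
        have hxX := loops_subset (hπX L hL) hx
        exact ⟨⟨⟨hR.mem_points_of_mem_curve (hXY ▸ Or.inl hxX) hab h.1 h.2, h⟩, hxX⟩, hx⟩
      · rintro ⟨⟨h, -⟩, hx⟩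
        exact ⟨hx, h.2⟩
    have hfinL := hR₀.isArcwise.finite_loops
    -- A double count of pairs of a point of `X` on the edge and a loop of `curve R₀` modelled by
    -- the loop through that point: summing over loops gives the weight of `curve R₀`, summing over
    -- points the number of copies.
    rw [(hcount a b).1, ← hR₀.edgeWeight_curve hab, ← hR₀.isArcwise.sum_edgeWeight_loops hab,
      finsum_mem_eq_finite_toFinset_sum _ hfin,
      Finset.sum_congr rfl fun L hL ↦ hloop L (hfinL.mem_toFinset.mp hL)]
    simp only [Finset.card_filter]
    rw [Finset.sum_comm]
    refine Finset.sum_congr rfl fun p hp ↦ ?_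
    have hpX : p ∈ X := (hfin.mem_toFinset.mp hp).2
    simp only [m, if_pos hpX]
    rw [← Finset.card_filter, ← Set.ncard_coe_finset]
    congr 1
    ext L
    simp
  -- The part outside `X` has multiplicity one, so its new copy has the same edge weights as `Y` and
  -- is isotopic to it.
  · have hYc : Y = curve (restrict R Xᶜ) := by
      ext x
      constructor
      · intro hx
        obtain ⟨a, p, q, h, hxs⟩ : x ∈ curve R := hXY ▸ Or.inr hx
        exact ⟨a, p, q, ⟨h, fun hp ↦ Set.disjoint_left.mp hXYd
          (hseg h (left_mem_seg p q) hp hxs) hx⟩, hxs⟩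
      · rintro ⟨a, p, q, ⟨h, hp⟩, hxs⟩
        have hx : x ∈ X ∪ Y := hXY ▸ ⟨a, p, q, h, hxs⟩
        exact hx.resolve_left fun hx ↦ hp (hseg h hxs hx (left_mem_seg p q))
    have hres : IsPattern (restrict R Xᶜ) := hR.restrict fun a p q h hp hq ↦
      hp (hS a q p (hR.symm h) hq)
    rw [hYc]
    refine hres.normallyIsotopic hR₂ fun a b hab ↦ ?_
    rw [(hcount a b).2, edgePoints_restrict, ← finsum_one]
    exact finsum_mem_congr rfl fun p hp ↦ (if_neg hp.2).symm

/-- The edge weights of the loops of a normal curve. -/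
def loopWeights (K : Set Tet) : Set (Fin 4 → Fin 4 → ℕ) :=
  -- A diagonal entry would count points of a whole face instead of an edge, so it is set to zero.
  (fun L a b ↦ if a = b then 0 else edgeWeight L a b) '' loops K

theorem IsNormalCurve.isArcwise {K : Set Tet} (h : IsNormalCurve K) (hK : IsCompact K) :
    IsArcwise K := by
  obtain ⟨K₀, hK₀, hiso⟩ := h
  obtain ⟨f, hf⟩ := hiso.exists_homeomorph hK
  obtain ⟨R, hR, rfl⟩ := hK₀.exists_pattern
  exact hR.isArcwise.of_homeomorph hK f hf

theorem loopWeights_subset {K : Set Tet} (hK : IsArcwise K) {B : ℕ}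
    (hB : ∀ L ∈ loops K, loopLength L ≤ B) : loopWeights K ⊆ {w | ∀ a b, w a b ≤ B} := by
  rintro _ ⟨L, hL, rfl⟩ a b
  by_cases hab : a = b
  · simp [hab]
  · simpa [hab] using (hK.edgeWeight_le_loopLength hL hab).trans (hB L hL)

theorem CanBeMadeDisjoint.of_loopWeights {K K' G : Set Tet} (h : CanBeMadeDisjoint K' G)
    (hK : IsCompact K) (hK' : IsCompact K') (hG : IsCompact G) (hnormal : IsNormalCurve K)
    (hw : loopWeights K ⊆ loopWeights K') : CanBeMadeDisjoint K G := by
  refine h.of_loops hK hK' hG hnormal fun L hL ↦ ?_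
  obtain ⟨L', hL', he⟩ := hw ⟨L, hL, rfl⟩
  refine ⟨L', hL', fun a b hab ↦ ?_⟩
  have := congrFun (congrFun he a) b
  simpa [hab] using this.symm

theorem isClosed_tetBoundary : IsClosed tetBoundary := by
  have : tetBoundary = ⋃ a, {x : Tet | x.1 a = 0} := by
    ext x
    simp only [Set.mem_iUnion]
    rfl
  rw [this]
  exact isClosed_iUnion_of_finite fun a ↦
    isClosed_eq ((continuous_apply a).comp continuous_subtype_val) continuous_const

/-! ### Finiteness of the typed classes of bounded complexity. -/

namespace Triangulation

section

variable {M : Type*} [TopologicalSpace M] [T2Space M] {𝒯 : Triangulation M}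

theorem isCompact_trace {S : Set M} (hS : IsCompact S) (i : 𝒯.ι) : IsCompact (𝒯.trace S i) :=
  (isClosed_tetBoundary.inter (hS.isClosed.preimage (𝒯.χ i).continuous)).isCompact

omit [T2Space M] in
theorem loopLength_le {D : Set (Set M)} {c : ℕ} (hD : 𝒯.classComplexity D ≤ c) {S : Set M}
    (hS : S ∈ D) (i : 𝒯.ι) {L : Set Tet} (hL : L ∈ loops (𝒯.trace S i)) :
    loopLength L ≤ 4 * c + 7 := by
  have h1 : (loopComplexity L : ℕ∞) ≤ c :=
    calc (loopComplexity L : ℕ∞)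
        ≤ ⨆ L ∈ loops (𝒯.trace S i), (loopComplexity L : ℕ∞) :=
          le_iSup₂ (f := fun L (_ : L ∈ loops (𝒯.trace S i)) ↦ (loopComplexity L : ℕ∞)) L hL
      _ ≤ 𝒯.surfaceComplexity S :=
          le_iSup (fun i ↦ ⨆ L ∈ loops (𝒯.trace S i), (loopComplexity L : ℕ∞)) i
      _ ≤ 𝒯.classComplexity D :=
          le_iSup₂ (f := fun S (_ : S ∈ D) ↦ 𝒯.surfaceComplexity S) S hS
      _ ≤ c := hD
  have h2 : loopComplexity L ≤ c := by exact_mod_cast h1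
  -- The quotient by `4` is rounded down, so `loopLength L / 4 ≤ c + 1` only gives `loopLength L < 4
  -- * (c + 2)`.
  unfold loopComplexity at h2
  omega

end

variable {M : Type*} [TopologicalSpace M] [ChartedSpace (EuclideanHalfSpace 3) M] [T2Space M]
  {𝒯 : Triangulation M}

/-- The edge weights of the normal loops of the members of a class of surfaces. -/
def classWeights (𝒯 : Triangulation M) (D : Set (Set M)) :
    Set (𝒯.ι → Set (Fin 4 → Fin 4 → ℕ)) :=
  (fun S i ↦ loopWeights (𝒯.trace S i)) '' D

/-- `S` inherits from `F` the compatibility with every member of `C`, so `S` can be added to `C`,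
and maximality applies. -/
theorem IsCompatibilityClass.mem_of_weights {C : Set (Set M)} (hC : 𝒯.IsCompatibilityClass C)
    {S F : Set M} (hS : 𝒯.IsNormalSurface S) (hSS : 𝒯.Compatible S S) (hF : F ∈ C)
    (h : ∀ i, loopWeights (𝒯.trace S i) ⊆ loopWeights (𝒯.trace F i)) : S ∈ C := by
  have hSG : ∀ G ∈ C, 𝒯.Compatible S G := fun G hG i ↦
    (hC.prop.2 F hF G hG i).of_loopWeights (isCompact_trace hS.1.1 i)
      (isCompact_trace (hC.prop.1 F hF).1.1 i) (isCompact_trace (hC.prop.1 G hG).1.1 i) (hS.2 i) (h i)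
  refine hC.le_of_ge ⟨?_, ?_⟩ (Set.subset_insert S C) (Set.mem_insert S C)
  · rintro G (rfl | hG)
    exacts [hS, hC.prop.1 G hG]
  · rintro G (rfl | hG) G' (rfl | hG')
    exacts [hSS, hSG G' hG', fun i ↦ (hSG G hG i).symm, hC.prop.2 G hG G' hG']

/-- A member `S` of the first class shares its weights with some `F` in the second, hence lies in
`C'`. Its types belong to `S` itself and need no transfer. -/
theorem typedClass_subset {T₁ T₂ : Set M} {t₁ : 𝒯.FaceIn T₁} {t₂ : 𝒯.FaceIn T₂}
    {C C' : Set (Set M)} (hC : 𝒯.IsCompatibilityClass C) (hC' : 𝒯.IsCompatibilityClass C')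
    {b₁ b₂ : Fin 4}
    (h : 𝒯.classWeights {S ∈ C | HasType t₁ S b₁ ∧ HasType t₂ S b₂} =
      𝒯.classWeights {S ∈ C' | HasType t₁ S b₁ ∧ HasType t₂ S b₂}) :
    {S ∈ C | HasType t₁ S b₁ ∧ HasType t₂ S b₂} ⊆
      {S ∈ C' | HasType t₁ S b₁ ∧ HasType t₂ S b₂} := by
  intro S hS
  obtain ⟨F, hF, hFS⟩ : (fun i ↦ loopWeights (𝒯.trace S i)) ∈
      𝒯.classWeights {S ∈ C' | HasType t₁ S b₁ ∧ HasType t₂ S b₂} := h ▸ ⟨S, hS, rfl⟩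
  exact ⟨hC'.mem_of_weights (hC.prop.1 S hS.1) (hC.prop.2 S hS.1 S hS.1) hF.1
    fun i ↦ (congrFun hFS i).ge, hS.2⟩

/-- There are only finitely many typed compatibility classes of bounded complexity. -/
theorem finite_typedClasses {T₁ T₂ : Set M} (t₁ : 𝒯.FaceIn T₁) (t₂ : 𝒯.FaceIn T₂) (c : ℕ) :
    {D | IsTypedClass t₁ t₂ D ∧ 𝒯.classComplexity D ≤ c}.Finite := by
  have := 𝒯.finite
  have hW : {w : Fin 4 → Fin 4 → ℕ | ∀ a b, w a b ≤ 4 * c + 7}.Finite := by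
    have h : ∀ _ : Fin 4, {u : Fin 4 → ℕ | ∀ b, u b ≤ 4 * c + 7}.Finite := fun _ ↦
      Set.Finite.pi' fun _ ↦ Set.finite_Iic (4 * c + 7)
    exact Set.Finite.pi' h
  have hG : {g : 𝒯.ι → Set (Fin 4 → Fin 4 → ℕ) | ∀ i,
      g i ∈ 𝒫 {w : Fin 4 → Fin 4 → ℕ | ∀ a b, w a b ≤ 4 * c + 7}}.Finite :=
    Set.Finite.pi' fun _ ↦ hW.powerset
  refine (Set.finite_iUnion fun b : Fin 4 × Fin 4 ↦ ?_ :
    (⋃ b : Fin 4 × Fin 4, {D | 𝒯.classComplexity D ≤ c ∧ ∃ C, 𝒯.IsCompatibilityClass C ∧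
      D = {S ∈ C | HasType t₁ S b.1 ∧ HasType t₂ S b.2}}).Finite).subset ?_
  -- For a fixed pair of types, `classWeights` is injective on the classes in question and takes
  -- values in the subsets of a finite set.
  · refine Set.Finite.of_injOn (f := 𝒯.classWeights) (t := 𝒫 _) ?_ ?_ hG.powerset
    · rintro D ⟨hD, C, hC, hDC⟩ _ ⟨S, hS, rfl⟩ i
      have hSC : S ∈ C := (hDC ▸ hS : S ∈ {S ∈ C | _}).1
      have hSn := hC.prop.1 S hSC
      exact loopWeights_subset ((hSn.2 i).isArcwise (isCompact_trace hSn.1.1 i))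
        fun L hL ↦ loopLength_le hD hS i hL
    · rintro _ ⟨-, C, hC, rfl⟩ _ ⟨-, C', hC', rfl⟩ h
      exact (typedClass_subset hC hC' h).antisymm (typedClass_subset hC' hC h.symm)
  · rintro D ⟨⟨-, C, hC, b₁, b₂, -, -, hD⟩, hDc⟩
    exact Set.mem_iUnion_of_mem (b₁, b₂) ⟨hDc, C, hC, hD⟩

end Triangulation

end Compatibility

end GluingDistance

end

open GluingDistance

theorem theorem1p3 {M : Type*} [TopologicalSpace M] [T2Space M] [CompactSpace M]
    [ChartedSpace (EuclideanHalfSpace 3) M]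
    (hirr : IsIrreducible M) (hinc : HasIncompressibleBoundary M)
    (𝒯 : Triangulation M) (o : 𝒯.Orientation)
    (T₁ T₂ : Set M) (hT₁ : IsBoundaryComponent T₁) (hT₂ : IsBoundaryComponent T₂) (hT : T₁ ≠ T₂)
    (hv₁ : 𝒯.OneVertexOn T₁) (hv₂ : 𝒯.OneVertexOn T₂)
    (β₁ : HomologyBasis 𝒯 o T₁ 1) (β₂ : HomologyBasis 𝒯 o T₂ (-1))
    (t₁ : 𝒯.FaceIn T₁) (t₂ : 𝒯.FaceIn T₂)
    (Φ : Set (Set M) → Matrix.SpecialLinearGroup (Fin 2) ℚ)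
    (hΦ : IsChoiceOfTransfers β₁.homeo β₂.homeo t₁ t₂ Φ)
    (ψ : T₁ ≃ₜ T₂) (hψ : PreservesOrientation β₁.homeo β₂.homeo ψ)
    (σ : T₂ ≃ₜ T₂) (hσ : IsAnosov β₂.homeo σ) (c : ℕ) :
    ∃ N : ℕ, 0 < N ∧ ∀ n, N ≤ n →
      1 ≤ cDistance β₁.homeo β₂.homeo t₁ t₂ Φ c (ψ.trans (σ ^ n)) := by
  have hfin := Triangulation.finite_typedClasses t₁ t₂ c
  -- The threshold depends on `D` through `Φ D`; finiteness of the set of classes bounds it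
  -- uniformly.
  choose N hN using fun D ↦ eventually_one_le_mapDistance hψ hσ (Φ D)
  obtain ⟨B, hB⟩ := (hfin.image N).bddAbove
  refine ⟨B + 1, Nat.succ_pos B, fun n hn ↦ le_iInf fun D ↦ le_iInf fun hD ↦ le_iInf fun hc ↦
    hN D n ?_⟩
  have : N D ≤ B := hB ⟨D, ⟨hD, hc⟩, rfl⟩
  omega
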